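/- Work over a field $\Bbbk$ of characteristic zero (for instance $\Bbbk=\mathbb{Q}$); graded vector spaces are concentrated in degrees $\geq 1$, and $\mathbb{L}(W)=\bigoplus_{l\geq 1}\mathbb{L}^{[l]}(W)$ denotes the free graded Lie algebra on $W$, graded by bracket length. A free dgl is a free graded Lie algebra with a differential, that is, a derivation of degree $-1$ and of square zero. A free dgl $(\mathbb{L}(V),d)$ is minimal if $dV\subset\mathbb{L}^{[\geq 2]}(V)$; its quadratic part $d_2$ is then the differential on $\mathbb{L}(V)$ which sends a generator $v\in V$ to the component of $dv$ in $\mathbb{L}^{[2]}(V)$. A decomposition of length $k$ of a free dgl $(\mathbb{L}(V),d)$ is a direct sum decomposition $V=V_{(1)}\oplus\dots\oplus V_{(k)}$ into graded subspaces such that $d|_{V_{(1)}}=0$ and $dV_{(i)}\subset\mathbb{L}(V_{<(i)})$ for $2\leq i\leq k$, where $V_{<(i)}=\bigoplus_{j<i}V_{(j)}$. A minimal model of a free dgl, seen as a sub-dgl, is a minimal dgl together with an injective dgl morphism to it that induces an isomorphism in homology. Proposition. Let $(\mathbb{L}(W),\delta)$ be a free dgl that has a decomposition of length $k$. Then $(\mathbb{L}(W),\delta)$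 has a minimal model that is a sub-dgl, and each such minimal model $M\subset(\mathbb{L}(W),\delta)$ has the following properties. 1) For every graded subspace of generators $V$ of $M$, that is, for every identification $M=(\mathbb{L}(V),\delta)$, the quadratic part $\delta_2$ of $\delta$ on $\mathbb{L}(V)$ is such that $(\mathbb{L}(V),\delta_2)$ has a decomposition of length $k$. 2) The graded subspace of generators $\overline{K}$ of $M$, with $M=(\mathbb{L}(\overline{K}),\delta)$, can be chosen so that $(\mathbb{L}(\overline{K}),\delta_2)$ has a decomposition $\overline{K}=\overline{K}_{(1)}\oplus\dots\oplus\overline{K}_{(k)}$ of length $k$ for which, moreover, $\delta\overline{K}\subset\mathbb{L}(\overline{K}_{<(k)})$. -/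

import Mathlib

universe u v

namespace GradedLie

/-- A graded vector space `W = ⊕_{i ≥ 1} W_i` over `𝕜`; `deg i` is the subspace `W_i`. -/
structure GradedSpace (𝕜 : Type v) [Field 𝕜] where
  carrier : Type u
  [addCommGroup : AddCommGroup carrier]
  [module : Module 𝕜 carrier]
  deg : ℕ → Submodule 𝕜 carrier
  isInternal : DirectSum.IsInternal deg
  deg_zero : deg 0 = ⊥

attribute [instance] GradedSpace.addCommGroup GradedSpace.module

variable {𝕜 : Type v} [Field 𝕜]

/-- The tensor algebra of the total space of `W`. -/
abbrev Tensor (W : GradedSpace.{u, v} 𝕜) : Type (max u v) := TensorAlgebra 𝕜 W.carrier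

/-- The graded commutator `[a, b] = ab - (-1)^{mn} ba` of elements `a` of degree `m` and `b` of
degree `n` of the tensor algebra. -/
def bracket (W : GradedSpace.{u, v} 𝕜) (m n : ℕ) (a b : Tensor W) : Tensor W :=
  a * b - (-1 : 𝕜) ^ (m * n) • (b * a)

/-- `IsLieMonomial W U n l x`: `x` is an iterated bracket, of total degree `n` and of bracket
length `l`, of homogeneous elements of the subspace `U` of `W`. -/
inductive IsLieMonomial (W : GradedSpace.{u, v} 𝕜) (U : Submodule 𝕜 W.carrier) :
    ℕ → ℕ → Tensor W → Prop
  | gen {n : ℕ} {w : W.carrier} (hU : w ∈ U) (hn : w ∈ W.deg n) :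
      IsLieMonomial W U n 1 (TensorAlgebra.ι 𝕜 w)
  | bracket {m n p q : ℕ} {a b : Tensor W} (ha : IsLieMonomial W U m p a)
      (hb : IsLieMonomial W U n q b) :
      IsLieMonomial W U (m + n) (p + q) (bracket W m n a b)

/-- For a graded subspace `U` of `W`, the graded Lie subalgebra `𝕃(U)` of `𝕃(W)`, both realized
as graded Lie subalgebras of the tensor algebra of `W`. -/
def lieOn (W : GradedSpace.{u, v} 𝕜) (U : Submodule 𝕜 W.carrier) : Submodule 𝕜 (Tensor W) :=
  Submodule.span 𝕜 {x | ∃ n l, IsLieMonomial W U n l x}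

/-- The free graded Lie algebra `𝕃(W)` over a field of characteristic zero: the graded Lie
subalgebra of the tensor algebra of `W` (with the graded commutator) that is generated by `W`. -/
def freeLie (W : GradedSpace.{u, v} 𝕜) : Submodule 𝕜 (Tensor W) := lieOn W ⊤

/-- The subspace `𝕃(W)_n` of elements of degree `n`. -/
def freeLieDeg (W : GradedSpace.{u, v} 𝕜) (n : ℕ) : Submodule 𝕜 (Tensor W) :=
  Submodule.span 𝕜 {x | ∃ l, IsLieMonomial W ⊤ n l x}

/-- The subspace `𝕃^{[l]}(W)` of elements of bracket length `l`. -/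
def freeLieLength (W : GradedSpace.{u, v} 𝕜) (l : ℕ) : Submodule 𝕜 (Tensor W) :=
  Submodule.span 𝕜 {x | ∃ n, IsLieMonomial W ⊤ n l x}

theorem bracket_mem_freeLie {W : GradedSpace.{u, v} 𝕜} {m n : ℕ} {a b : Tensor W}
    (ha : a ∈ freeLieDeg W m) (hb : b ∈ freeLieDeg W n) : bracket W m n a b ∈ freeLie W := by
  induction ha using Submodule.span_induction with
  | mem a ha =>
    induction hb using Submodule.span_induction with
    | mem b hb =>
      obtain ⟨p, hp⟩ := ha
      obtain ⟨q, hq⟩ := hb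
      exact Submodule.subset_span ⟨_, _, hp.bracket hq⟩
    | zero => simp [bracket]
    | add x y _ _ hx hy =>
      have h : bracket W m n a (x + y) = bracket W m n a x + bracket W m n a y := by
        simp only [bracket, mul_add, add_mul, smul_add]; abel
      rw [h]; exact add_mem hx hy
    | smul c x _ hx =>
      have h : bracket W m n a (c • x) = c • bracket W m n a x := by
        simp only [bracket, mul_smul_comm, smul_mul_assoc, smul_sub, smul_comm c]
      rw [h]; exact Submodule.smul_mem _ c hx
  | zero => simp [bracket]
  | add x y _ _ hx hy =>
    have h : bracket W m n (x + y) b = bracket W m n x b + bracket W m n y b := by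
      simp only [bracket, mul_add, add_mul, smul_add]; abel
    rw [h]; exact add_mem hx hy
  | smul c x _ hx =>
    have h : bracket W m n (c • x) b = c • bracket W m n x b := by
      simp only [bracket, mul_smul_comm, smul_mul_assoc, smul_sub, smul_comm c]
    rw [h]; exact Submodule.smul_mem _ c hx

theorem ι_mem_freeLie (W : GradedSpace.{u, v} 𝕜) (w : W.carrier) :
    TensorAlgebra.ι 𝕜 w ∈ freeLie W := by
  have h : (⨆ n, W.deg n) ≤ (freeLie W).comap (TensorAlgebra.ι 𝕜) :=
    iSup_le fun n x hx => Submodule.subset_span ⟨n, 1, .gen trivial hx⟩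
  rw [W.isInternal.submodule_iSup_eq_top] at h
  exact h trivial

/-- The inclusion of the generators, `W → 𝕃(W)`. -/
def gen (W : GradedSpace.{u, v} 𝕜) : W.carrier →ₗ[𝕜] freeLie W :=
  (TensorAlgebra.ι 𝕜).codRestrict (freeLie W) (ι_mem_freeLie W)

/-- The bracket of two homogeneous elements of `𝕃(W)`, of degrees `m` and `n`. -/
def lie {W : GradedSpace.{u, v} 𝕜} {m n : ℕ} (a b : freeLie W)
    (ha : (a : Tensor W) ∈ freeLieDeg W m) (hb : (b : Tensor W) ∈ freeLieDeg W n) : freeLie W :=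
  ⟨bracket W m n a b, bracket_mem_freeLie ha hb⟩

/-- A differential on `𝕃(W)`: a derivation of degree `-1` and of square zero. A pair
`(W, δ)` with `δ : Differential W` is the free dgl `(𝕃(W), δ)`. (As `𝕃(W)` vanishes in degree
zero, every homogeneous element is zero or of degree `n + 1` for some `n : ℕ`.) -/
structure Differential (W : GradedSpace.{u, v} 𝕜) where
  d : freeLie W →ₗ[𝕜] freeLie W
  d_deg : ∀ (n : ℕ) (a : freeLie W), (a : Tensor W) ∈ freeLieDeg W (n + 1) →
    (d a : Tensor W) ∈ freeLieDeg W n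
  d_lie : ∀ (m n : ℕ) (a b : freeLie W) (ha : (a : Tensor W) ∈ freeLieDeg W (m + 1))
    (hb : (b : Tensor W) ∈ freeLieDeg W (n + 1)),
    d (lie a b ha hb) =
      lie (d a) b (d_deg m a ha) hb + (-1 : 𝕜) ^ (m + 1) • lie a (d b) ha (d_deg n b hb)
  d_d : ∀ a, d (d a) = 0

/-- The dgl `(𝕃(W), δ)` is minimal: `δ W ⊆ 𝕃^{≥ 2}(W)`. -/
def Differential.IsMinimal {W : GradedSpace.{u, v} 𝕜} (δ : Differential W) : Prop :=
  ∀ w : W.carrier, (δ.d (gen W w) : Tensor W) ∈ ⨆ (l : ℕ) (_ : 2 ≤ l), freeLieLength W l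

/-- The differential `δ₂` is the quadratic part of `δ`: it is the derivation whose value on a
generator `w` is the component of `δ w` in `𝕃^{[2]}(W)`. -/
def Differential.IsQuadraticPart {W : GradedSpace.{u, v} 𝕜} (δ δ₂ : Differential W) : Prop :=
  ∀ w : W.carrier, (δ₂.d (gen W w) : Tensor W) ∈ freeLieLength W 2 ∧
    ((δ.d (gen W w) - δ₂.d (gen W w) : freeLie W) : Tensor W) ∈
      ⨆ (l : ℕ) (_ : l ≠ 2), freeLieLength W l

/-- For a family `W_(1), …, W_(k)` of subspaces, `below P m` is the sum `W_{<(m)}` of the `W_(j)`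
with `j < m`. The subspace `W_(j)` is `P i` for the `i : Fin k` of value `j - 1`. -/
def below {W : GradedSpace.{u, v} 𝕜} {k : ℕ} (P : Fin k → Submodule 𝕜 W.carrier) (m : ℕ) :
    Submodule 𝕜 W.carrier :=
  ⨆ (i : Fin k) (_ : (i : ℕ) + 1 < m), P i

/-- A decomposition of length `k` of `(𝕃(W), δ)`: a direct sum decomposition
`W = W_(1) ⊕ ⋯ ⊕ W_(k)` into graded subspaces with `δ W_(j) ⊆ 𝕃(W_{<(j)})` for all `j`. For `j = 1`
this says that `δ` vanishes on `W_(1)`, because `𝕃(0) = 0`. -/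
structure Decomposition {W : GradedSpace.{u, v} 𝕜} (δ : Differential W) (k : ℕ) where
  piece : Fin k → Submodule 𝕜 W.carrier
  isInternal : DirectSum.IsInternal piece
  graded : ∀ i, piece i = ⨆ n, piece i ⊓ W.deg n
  d_mem : ∀ (i : Fin k), ∀ w ∈ piece i,
    (δ.d (gen W w) : Tensor W) ∈ lieOn W (below piece ((i : ℕ) + 1))

/-- A morphism of dgl's `(𝕃(V), d) → (𝕃(W), δ)`. -/
structure Hom {V W : GradedSpace.{u, v} 𝕜} (d : Differential V) (δ : Differential W) where
  toFun : freeLie V →ₗ[𝕜] freeLie W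
  map_deg : ∀ (n : ℕ) (a : freeLie V), (a : Tensor V) ∈ freeLieDeg V n →
    (toFun a : Tensor W) ∈ freeLieDeg W n
  map_lie : ∀ (m n : ℕ) (a b : freeLie V) (ha : (a : Tensor V) ∈ freeLieDeg V m)
    (hb : (b : Tensor V) ∈ freeLieDeg V n),
    toFun (lie a b ha hb) = lie (toFun a) (toFun b) (map_deg m a ha) (map_deg n b hb)
  map_d : ∀ a, toFun (d.d a) = δ.d (toFun a)

instance {W : GradedSpace.{u, v} 𝕜} (δ : Differential W) : AddCommGroup (LinearMap.ker δ.d) :=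
  Module.addCommMonoidToAddCommGroup 𝕜

/-- The homology `ker δ / im δ` of `(𝕃(W), δ)`. -/
abbrev Differential.Homology {W : GradedSpace.{u, v} 𝕜} (δ : Differential W) : Type (max u v) :=
  LinearMap.ker δ.d ⧸ (LinearMap.range δ.d).submoduleOf (LinearMap.ker δ.d)

/-- The map induced in homology by a morphism of dgl's. -/
def Hom.homologyMap {V W : GradedSpace.{u, v} 𝕜} {d : Differential V} {δ : Differential W}
    (f : Hom d δ) : d.Homology →ₗ[𝕜] δ.Homology :=
  Submodule.mapQ _ _
    (f.toFun.restrict (p := LinearMap.ker d.d) (q := LinearMap.ker δ.d) (fun x hx => by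
      rw [LinearMap.mem_ker] at hx ⊢
      rw [← f.map_d, hx, map_zero]))
    (by
      rintro ⟨x, hx⟩ ⟨y, hy⟩
      exact ⟨f.toFun y, by rw [← f.map_d, hy]; rfl⟩)

/-- The morphism `f : (𝕃(V), d) → (𝕃(W), δ)` exhibits `(𝕃(V), d)` as a minimal model of
`(𝕃(W), δ)` that is a sub-dgl: `d` is minimal, and `f` is an injective quasi-isomorphism. -/
structure Hom.IsMinimalModel {V W : GradedSpace.{u, v} 𝕜} {d : Differential V}
    {δ : Differential W} (f : Hom d δ) : Prop where
  minimal : d.IsMinimal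
  injective : Function.Injective f.toFun
  quasiIso : Function.Bijective f.homologyMap

end GradedLie

/-! The linear part `e` of `δ` is a differential on `W` and lowers the filtration `F i = W_(1) ⊕ ⋯ ⊕
W_(i)` by one step. The complex `(W, e)` contracts to its homology by a graded projection `p` and a
homotopy `h` with `p + he + eh = 1`. Graded subspaces have projections compatible with the
filtration, so `p` can be chosen to preserve every `F i` (`exists_contraction`); nothing of the kind
is asked of `h`.

The substitution `α w = p w + h e w + δ h w` is the identity on linear parts, hence an automorphism
of `𝕃(W)`, and the transported differential satisfies `δ' h w = e h w` exactly
(`exists_strictContraction`). Killing the contractible generators `h w` and `e h w` gives a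
projection `P` onto a minimal free dgl on `S = im p`. Let `H` be the odd derivation that extends
`h`. The derivation `N = δ'H + Hδ'` is the identity on the contractible generators and maps `S` into
the ideal that they generate. So its generalized eigenvalues are natural numbers, and they are
positive on the kernel of `P`. In characteristic zero `N` is therefore invertible on that kernel,
which makes the kernel acyclic, while the kernel of `N` supplies a section of `P` (`isQuasiIso_P`,
`exists_section`). Thus `𝕃(S)` is a minimal model that is both a sub-dgl and a retract.

The retraction `f = P α⁻¹` has linear part `p`, and quadratic parts are natural
(`Differential.IsMinimal.lenComp_two_linMap`). For `s` in `S ∩ F (i + 1)` the element `δ s` lies in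
`𝕃(F i)` and has no linear part, so the quadratic part of the new differential sends `s` into `𝕃(S ∩
F i)`; splitting this filtration yields a decomposition. The full differential can violate it,
because `α` involves `h`. At the top step it does not: `δ W ⊆ 𝕃(F (k - 1))` forces `he = 1 - p - eh`
to preserve `F (k - 1)`, so `α` restricts to an automorphism of `𝕃(F (k - 1))`.

For an arbitrary minimal model `φ`, the composite `f φ` is a quasi-isomorphism of minimal dgl's,
hence an isomorphism (`IsQuasiIso.linBijective`). Its linear part carries the filtration back to the
given generators, which proves 1); the space `S` itself serves as the generators in 2). -/

namespace GradedLie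

open TensorAlgebra Polynomial

variable {𝕜 : Type v} [Field 𝕜]

/-! ### Linear maps on graded spaces -/

namespace GradedSpace

variable (W : GradedSpace.{u, v} 𝕜)

/-- The linear map on `W` that is given by `g n` on the elements of degree `n`. -/
noncomputable def lift {E : Type*} [AddCommGroup E] [Module 𝕜 E] (g : ∀ n, W.deg n →ₗ[𝕜] E) :
    W.carrier →ₗ[𝕜] E :=
  DirectSum.toModule 𝕜 ℕ E g ∘ₗ
    (LinearEquiv.ofBijective (DirectSum.coeLinearMap W.deg) W.isInternal).symm.toLinearMap

theorem lift_apply {E : Type*} [AddCommGroup E] [Module 𝕜 E] (g : ∀ n, W.deg n →ₗ[𝕜] E)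
    {n : ℕ} {w : W.carrier} (hw : w ∈ W.deg n) : W.lift g w = g n ⟨w, hw⟩ := by
  have h : (LinearEquiv.ofBijective (DirectSum.coeLinearMap W.deg) W.isInternal).symm w =
      DirectSum.lof 𝕜 ℕ (fun n => W.deg n) n ⟨w, hw⟩ := by
    rw [LinearEquiv.symm_apply_eq]
    exact (DirectSum.coeLinearMap_lof W.deg n ⟨w, hw⟩).symm
  simp only [lift, LinearMap.comp_apply, LinearEquiv.coe_coe, h]
  exact DirectSum.toModule_lof 𝕜 n _

theorem le_of_deg_le {p : Submodule 𝕜 W.carrier} (h : ∀ n, W.deg n ≤ p) (w : W.carrier) :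
    w ∈ p := by
  have : (⨆ n, W.deg n) ≤ p := iSup_le h
  rw [W.isInternal.submodule_iSup_eq_top] at this
  exact this trivial

theorem hom_ext {E : Type*} [AddCommGroup E] [Module 𝕜 E] {f g : W.carrier →ₗ[𝕜] E}
    (h : ∀ n, ∀ w ∈ W.deg n, f w = g w) : f = g := by
  ext w
  have := W.le_of_deg_le (p := LinearMap.eqLocus f g) (fun n w hw => h n w hw) w
  exact this

theorem eq_zero_of_deg_zero {w : W.carrier} (hw : w ∈ W.deg 0) : w = 0 := by
  rwa [W.deg_zero, Submodule.mem_bot] at hw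

/-- The projection of `W` to `W_n`. -/
noncomputable def proj (n : ℕ) : W.carrier →ₗ[𝕜] W.carrier :=
  W.lift fun m => if m = n then (W.deg m).subtype else 0

theorem proj_same {n : ℕ} {w : W.carrier} (hw : w ∈ W.deg n) : W.proj n w = w := by
  simp [proj, W.lift_apply _ hw]

theorem proj_ne {n m : ℕ} {w : W.carrier} (hw : w ∈ W.deg m) (h : m ≠ n) : W.proj n w = 0 := by
  simp [proj, W.lift_apply _ hw, h]

theorem proj_mem (n : ℕ) (w : W.carrier) : W.proj n w ∈ W.deg n := by
  refine W.le_of_deg_le (p := (W.deg n).comap (W.proj n)) (fun m w hw => ?_) w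
  rw [Submodule.mem_comap]
  by_cases h : m = n
  · subst h; rwa [W.proj_same hw]
  · rw [W.proj_ne hw h]; exact zero_mem _

end GradedSpace

/-! ### Lie monomials -/

section Monomial

variable {W : GradedSpace.{u, v} 𝕜} {U : Submodule 𝕜 W.carrier}

theorem bracket_zero_left (m n : ℕ) (b : Tensor W) : bracket W m n 0 b = 0 := by simp [bracket]

theorem bracket_zero_right (m n : ℕ) (a : Tensor W) : bracket W m n a 0 = 0 := by simp [bracket]

theorem bracket_add_left (m n : ℕ) (x y b : Tensor W) :
    bracket W m n (x + y) b = bracket W m n x b + bracket W m n y b := by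
  simp only [bracket, mul_add, add_mul, smul_add]; abel

theorem bracket_add_right (m n : ℕ) (a x y : Tensor W) :
    bracket W m n a (x + y) = bracket W m n a x + bracket W m n a y := by
  simp only [bracket, mul_add, add_mul, smul_add]; abel

theorem bracket_smul_left (m n : ℕ) (c : 𝕜) (x b : Tensor W) :
    bracket W m n (c • x) b = c • bracket W m n x b := by
  simp only [bracket, mul_smul_comm, smul_mul_assoc, smul_sub, smul_comm c]

theorem bracket_smul_right (m n : ℕ) (c : 𝕜) (a x : Tensor W) :
    bracket W m n a (c • x) = c • bracket W m n a x := by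
  simp only [bracket, mul_smul_comm, smul_mul_assoc, smul_sub, smul_comm c]

/-- Generators start in degree one. This disposes of the degree-zero cases that the rules for
`Differential`, stated in degrees `n + 1`, leave out. -/
theorem IsLieMonomial.eq_zero_of_deg {l : ℕ} {x : Tensor W} (h : IsLieMonomial W U 0 l x) :
    x = 0 := by
  generalize hn : 0 = n at h
  induction h with
  | @gen n w hU hw =>
    subst hn
    rw [W.eq_zero_of_deg_zero hw, map_zero]
  | @bracket m n p q a b ha hb iha ihb => rw [iha (by omega), bracket_zero_left]

theorem IsLieMonomial.length_pos {n l : ℕ} {x : Tensor W} (h : IsLieMonomial W U n l x) :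
    1 ≤ l := by
  induction h with
  | gen => exact le_rfl
  | bracket _ _ iha _ => omega

theorem IsLieMonomial.mono {U' : Submodule 𝕜 W.carrier} (hU : U ≤ U') {n l : ℕ} {x : Tensor W}
    (h : IsLieMonomial W U n l x) : IsLieMonomial W U' n l x := by
  induction h with
  | gen h hn => exact .gen (hU h) hn
  | bracket _ _ iha ihb => exact iha.bracket ihb

/-- The elements of degree `n` of `𝕃(U)`. -/
def lieOnDeg (W : GradedSpace.{u, v} 𝕜) (U : Submodule 𝕜 W.carrier) (n : ℕ) :
    Submodule 𝕜 (Tensor W) :=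
  Submodule.span 𝕜 {x | ∃ l, IsLieMonomial W U n l x}

theorem lieOnDeg_le_lieOn (n : ℕ) : lieOnDeg W U n ≤ lieOn W U :=
  Submodule.span_mono fun _ ⟨l, h⟩ => ⟨n, l, h⟩

theorem freeLieDeg_le_freeLie (n : ℕ) : freeLieDeg W n ≤ freeLie W := lieOnDeg_le_lieOn n

theorem lieOn_mono {U' : Submodule 𝕜 W.carrier} (hU : U ≤ U') : lieOn W U ≤ lieOn W U' :=
  Submodule.span_mono fun _ ⟨n, l, h⟩ => ⟨n, l, h.mono hU⟩

theorem lieOn_le_freeLie : lieOn W U ≤ freeLie W := lieOn_mono le_top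

theorem ι_mem_lieOnDeg {n : ℕ} {w : W.carrier} (hU : w ∈ U) (hw : w ∈ W.deg n) :
    ι 𝕜 w ∈ lieOnDeg W U n :=
  Submodule.subset_span ⟨1, .gen hU hw⟩

theorem ι_mem_freeLieDeg {n : ℕ} {w : W.carrier} (hw : w ∈ W.deg n) :
    ι 𝕜 w ∈ freeLieDeg W n := ι_mem_lieOnDeg (U := ⊤) trivial hw

theorem bracket_mem_of_forall {A B C : Submodule 𝕜 (Tensor W)} {s t : Set (Tensor W)} {m n : ℕ}
    (hA : A = Submodule.span 𝕜 s) (hB : B = Submodule.span 𝕜 t)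
    (h : ∀ a ∈ s, ∀ b ∈ t, bracket W m n a b ∈ C) {a b : Tensor W} (ha : a ∈ A) (hb : b ∈ B) :
    bracket W m n a b ∈ C := by
  subst hA hB
  induction ha using Submodule.span_induction with
  | mem a ha =>
    induction hb using Submodule.span_induction with
    | mem b hb => exact h a ha b hb
    | zero => rw [bracket_zero_right]; exact zero_mem _
    | add x y _ _ hx hy => rw [bracket_add_right]; exact add_mem hx hy
    | smul c x _ hx => rw [bracket_smul_right]; exact Submodule.smul_mem _ c hx
  | zero => rw [bracket_zero_left]; exact zero_mem _
  | add x y _ _ hx hy => rw [bracket_add_left]; exact add_mem hx hy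
  | smul c x _ hx => rw [bracket_smul_left]; exact Submodule.smul_mem _ c hx

theorem bracket_mem_lieOnDeg {m n : ℕ} {a b : Tensor W} (ha : a ∈ lieOnDeg W U m)
    (hb : b ∈ lieOnDeg W U n) : bracket W m n a b ∈ lieOnDeg W U (m + n) :=
  bracket_mem_of_forall rfl rfl
    (by rintro _ ⟨_, ha⟩ _ ⟨_, hb⟩; exact Submodule.subset_span ⟨_, ha.bracket hb⟩) ha hb

theorem freeLieDeg_zero : freeLieDeg W 0 = ⊥ := by
  rw [eq_bot_iff]
  refine Submodule.span_le.2 ?_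
  rintro x ⟨l, h⟩
  exact h.eq_zero_of_deg

theorem freeLie_induction {p : Submodule 𝕜 (Tensor W)}
    (h : ∀ n l x, IsLieMonomial W U n l x → x ∈ p) {x : Tensor W} (hx : x ∈ lieOn W U) : x ∈ p :=
  Submodule.span_le.2 (by rintro x ⟨n, l, hx⟩; exact h n l x hx) hx

end Monomial

/-! ### Components of a given degree or length -/

section Components

variable (W : GradedSpace.{u, v} 𝕜)

/-- The algebra map that multiplies an element of degree `n` by `X ^ n`. -/
noncomputable def degPoly : Tensor W →ₐ[𝕜] (Tensor W)[X] :=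
  TensorAlgebra.lift 𝕜 (W.lift fun n =>
    ((monomial n : Tensor W →ₗ[Tensor W] (Tensor W)[X]).restrictScalars 𝕜) ∘ₗ
      ι 𝕜 ∘ₗ (W.deg n).subtype)

/-- The algebra map that multiplies an element of tensor length `l` by `X ^ l`. -/
noncomputable def lenPoly : Tensor W →ₐ[𝕜] (Tensor W)[X] :=
  TensorAlgebra.lift 𝕜
    (((monomial 1 : Tensor W →ₗ[Tensor W] (Tensor W)[X]).restrictScalars 𝕜) ∘ₗ ι 𝕜)

/-- The component of degree `n`. -/
noncomputable def degComp (n : ℕ) : Tensor W →ₗ[𝕜] Tensor W :=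
  ((lcoeff (Tensor W) n).restrictScalars 𝕜) ∘ₗ (degPoly W).toLinearMap

/-- The component of tensor length `l`. -/
noncomputable def lenComp (l : ℕ) : Tensor W →ₗ[𝕜] Tensor W :=
  ((lcoeff (Tensor W) l).restrictScalars 𝕜) ∘ₗ (lenPoly W).toLinearMap

variable {W} {U : Submodule 𝕜 W.carrier}

theorem degComp_apply (n : ℕ) (x : Tensor W) : degComp W n x = (degPoly W x).coeff n := rfl

theorem lenComp_apply (n : ℕ) (x : Tensor W) : lenComp W n x = (lenPoly W x).coeff n := rfl

theorem degPoly_ι {n : ℕ} {w : W.carrier} (hw : w ∈ W.deg n) :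
    degPoly W (ι 𝕜 w) = monomial n (ι 𝕜 w) := by
  simp [degPoly, W.lift_apply _ hw]

theorem lenPoly_ι (w : W.carrier) : lenPoly W (ι 𝕜 w) = monomial 1 (ι 𝕜 w) := by
  simp [lenPoly]

theorem IsLieMonomial.degPoly {n l : ℕ} {x : Tensor W} (h : IsLieMonomial W U n l x) :
    degPoly W x = monomial n x := by
  induction h with
  | gen _ hw => exact degPoly_ι hw
  | @bracket m n p q a b _ _ iha ihb =>
    rw [GradedLie.bracket, map_sub, map_smul, map_mul, map_mul, iha, ihb, monomial_mul_monomial,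
      monomial_mul_monomial, add_comm n m, map_sub, ← smul_monomial]

theorem IsLieMonomial.lenPoly {n l : ℕ} {x : Tensor W} (h : IsLieMonomial W U n l x) :
    lenPoly W x = monomial l x := by
  induction h with
  | gen _ hw => exact lenPoly_ι _
  | @bracket m n p q a b _ _ iha ihb =>
    rw [GradedLie.bracket, map_sub, map_smul, map_mul, map_mul, iha, ihb, monomial_mul_monomial,
      monomial_mul_monomial, add_comm q p, map_sub, ← smul_monomial]

theorem IsLieMonomial.degComp {n l : ℕ} {x : Tensor W} (h : IsLieMonomial W U n l x) (m : ℕ) :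
    degComp W m x = if n = m then x else 0 := by
  rw [degComp_apply, h.degPoly, coeff_monomial]

theorem IsLieMonomial.lenComp {n l : ℕ} {x : Tensor W} (h : IsLieMonomial W U n l x) (m : ℕ) :
    lenComp W m x = if l = m then x else 0 := by
  rw [lenComp_apply, h.lenPoly, coeff_monomial]

theorem degPoly_of_mem {n : ℕ} {x : Tensor W} (hx : x ∈ freeLieDeg W n) :
    degPoly W x = monomial n x := by
  have : freeLieDeg W n ≤ LinearMap.eqLocus (degPoly W).toLinearMap
      ((monomial n : Tensor W →ₗ[Tensor W] (Tensor W)[X]).restrictScalars 𝕜) :=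
    Submodule.span_le.2 fun x ⟨l, h⟩ => h.degPoly
  exact this hx

theorem degComp_of_mem {n : ℕ} {x : Tensor W} (hx : x ∈ freeLieDeg W n) (m : ℕ) :
    degComp W m x = if n = m then x else 0 := by
  rw [degComp_apply, degPoly_of_mem hx, coeff_monomial]

theorem degComp_mem_lieOnDeg (n : ℕ) {x : Tensor W} (hx : x ∈ lieOn W U) :
    degComp W n x ∈ lieOnDeg W U n := by
  refine freeLie_induction (p := (lieOnDeg W U n).comap (degComp W n)) (fun m l x hx => ?_) hx
  rw [Submodule.mem_comap, hx.degComp]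
  split_ifs with h
  · subst h; exact Submodule.subset_span ⟨l, hx⟩
  · exact zero_mem _

theorem lenComp_mem_lieOn (n : ℕ) {x : Tensor W} (hx : x ∈ lieOn W U) :
    lenComp W n x ∈ lieOn W U := by
  refine freeLie_induction (p := (lieOn W U).comap (lenComp W n)) (fun m l x hx => ?_) hx
  rw [Submodule.mem_comap, hx.lenComp]
  split_ifs with h
  · exact Submodule.subset_span ⟨m, l, hx⟩
  · exact zero_mem _

theorem lenComp_mem_freeLieLength (n : ℕ) {x : Tensor W} (hx : x ∈ freeLie W) :
    lenComp W n x ∈ freeLieLength W n := by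
  refine freeLie_induction (p := (freeLieLength W n).comap (lenComp W n))
    (fun m l x hx => ?_) hx
  rw [Submodule.mem_comap, hx.lenComp]
  split_ifs with h
  · subst h; exact Submodule.subset_span ⟨m, hx⟩
  · exact zero_mem _

theorem lenComp_mem_lieOnDeg (m n : ℕ) {x : Tensor W} (hx : x ∈ lieOnDeg W U m) :
    lenComp W n x ∈ lieOnDeg W U m := by
  refine (Submodule.span_le (p := (lieOnDeg W U m).comap (lenComp W n))).2 ?_ hx
  rintro x ⟨l, hx⟩
  rw [SetLike.mem_coe, Submodule.mem_comap, hx.lenComp]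
  split_ifs with h
  · exact Submodule.subset_span ⟨l, hx⟩
  · exact zero_mem _

/-- The projection to degree `n` fixes `x` and maps `𝕃(U)` to its part of degree `n`. -/
theorem mem_lieOnDeg_of_mem {n : ℕ} {x : Tensor W} (hx : x ∈ lieOn W U)
    (hn : x ∈ freeLieDeg W n) : x ∈ lieOnDeg W U n := by
  have := degComp_mem_lieOnDeg n hx
  rwa [degComp_of_mem hn, if_pos rfl] at this

/-- An element of `𝕃(W)` all of whose homogeneous components lie in a subspace lies in it. -/
theorem mem_of_forall_degComp {p : Submodule 𝕜 (Tensor W)} {x : Tensor W} (hx : x ∈ freeLie W)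
    (h : ∀ n, degComp W n x ∈ p) : x ∈ p := by
  -- Adding up the coefficients is evaluation at `X = 1`, so an element is the finite sum of its
  -- components.
  have key : x = (degPoly W x).sum fun n a => a := by
    have : freeLie W ≤ LinearMap.eqLocus LinearMap.id
        (((lsum fun _ => LinearMap.id : (Tensor W)[X] →ₗ[Tensor W] Tensor W).restrictScalars 𝕜) ∘ₗ
          (degPoly W).toLinearMap) := by
      refine Submodule.span_le.2 fun x ⟨n, l, hx⟩ => ?_
      simp [LinearMap.mem_eqLocus, hx.degPoly]
    have h := this hx
    rw [LinearMap.mem_eqLocus] at h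
    simpa using h
  rw [key, Polynomial.sum]
  exact sum_mem fun n _ => h n

end Components

/-! ### Linear parts -/

section Lin

variable {W : GradedSpace.{u, v} 𝕜} {U : Submodule 𝕜 W.carrier}

/-- The linear part of an element of the tensor algebra. -/
noncomputable def lin (W : GradedSpace.{u, v} 𝕜) : Tensor W →ₗ[𝕜] W.carrier := TensorAlgebra.ιInv

@[simp] theorem lin_ι (w : W.carrier) : lin W (ι 𝕜 w) = w := TensorAlgebra.ι_leftInverse w

/-- The maps `algebraMapInv` and `lin` are the two components of the algebra map to the trivial
square-zero extension of `𝕜` by `W`; this is the product there. -/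
theorem lin_mul (x y : Tensor W) :
    lin W (x * y) = algebraMapInv x • lin W y + algebraMapInv y • lin W x := by
  -- The square-zero extension needs a right action of `𝕜`; the left action serves, by
  -- commutativity.
  let _ : Module 𝕜ᵐᵒᵖ W.carrier := Module.compHom _ ((RingHom.id 𝕜).fromOpposite mul_comm)
  have _ : IsCentralScalar 𝕜 W.carrier := ⟨fun r m => rfl⟩
  have h : ∀ x : Tensor W, TrivSqZeroExt.fst (toTrivSqZeroExt (R := 𝕜) x) = algebraMapInv x := by
    intro x
    have : (TrivSqZeroExt.fstHom 𝕜 𝕜 W.carrier).comp toTrivSqZeroExt = algebraMapInv := by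
      ext w; simp [algebraMapInv]
    exact DFunLike.congr_fun this x
  have h2 : ∀ x : Tensor W, lin W x = TrivSqZeroExt.snd (toTrivSqZeroExt (R := 𝕜) x) :=
    fun _ => rfl
  rw [h2, h2, h2, ← h, ← h, map_mul, TrivSqZeroExt.snd_mul, op_smul_eq_smul]

theorem IsLieMonomial.algebraMapInv {n l : ℕ} {x : Tensor W} (h : IsLieMonomial W U n l x) :
    algebraMapInv x = 0 := by
  induction h with
  | gen => simp [TensorAlgebra.algebraMapInv]
  | bracket _ _ iha ihb => simp [GradedLie.bracket, iha, ihb]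

theorem algebraMapInv_of_mem {x : Tensor W} (h : x ∈ freeLie W) : algebraMapInv x = 0 :=
  freeLie_induction (p := LinearMap.ker (algebraMapInv (R := 𝕜) (M := W.carrier)).toLinearMap)
    (fun _ _ _ h => h.algebraMapInv) h

theorem lin_bracket {m n : ℕ} {a b : Tensor W} (ha : a ∈ freeLie W) (hb : b ∈ freeLie W) :
    lin W (bracket W m n a b) = 0 := by
  simp [bracket, lin_mul, algebraMapInv_of_mem ha, algebraMapInv_of_mem hb]

theorem IsLieMonomial.mem_freeLie {n l : ℕ} {x : Tensor W} (h : IsLieMonomial W U n l x) :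
    x ∈ freeLie W := Submodule.subset_span ⟨n, l, h.mono le_top⟩

theorem IsLieMonomial.mem_freeLieDeg {n l : ℕ} {x : Tensor W} (h : IsLieMonomial W U n l x) :
    x ∈ freeLieDeg W n := Submodule.subset_span ⟨l, h.mono le_top⟩

/-- A Lie monomial is either a generator or of length at least two. -/
theorem IsLieMonomial.cases' {n l : ℕ} {x : Tensor W} (h : IsLieMonomial W U n l x) :
    (∃ w ∈ U ⊓ W.deg n, x = ι 𝕜 w ∧ l = 1) ∨ (2 ≤ l ∧ lin W x = 0 ∧
      ∃ i j p q a b, IsLieMonomial W U i p a ∧ IsLieMonomial W U j q b ∧ i + j = n ∧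
        x = GradedLie.bracket W i j a b) := by
  cases h with
  | gen hU hw => exact .inl ⟨_, ⟨hU, hw⟩, rfl, rfl⟩
  | bracket ha hb =>
    refine .inr ⟨?_, lin_bracket ha.mem_freeLie hb.mem_freeLie, _, _, _, _, _, _, ha, hb, rfl, rfl⟩
    have := ha.length_pos
    have := hb.length_pos
    omega

theorem lin_mem_deg {n : ℕ} {x : Tensor W} (hx : x ∈ lieOnDeg W U n) :
    lin W x ∈ U ⊓ W.deg n := by
  refine (Submodule.span_le (p := (U ⊓ W.deg n).comap (lin W))).2 ?_ hx
  rintro x ⟨l, h⟩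
  rw [SetLike.mem_coe, Submodule.mem_comap]
  rcases h.cases' with ⟨w, hw, rfl, -⟩ | ⟨-, h, -⟩
  · rwa [lin_ι]
  · rw [h]; exact zero_mem _

theorem lin_mem_of_lieOn {x : Tensor W} (hx : x ∈ lieOn W U) : lin W x ∈ U := by
  refine freeLie_induction (p := U.comap (lin W)) (fun n l x h => ?_) hx
  exact (lin_mem_deg (Submodule.subset_span ⟨l, h⟩)).1

/-- The span of the brackets, of total degree `n`, of elements of `𝕃(U)`. -/
def decomposables (W : GradedSpace.{u, v} 𝕜) (U : Submodule 𝕜 W.carrier) (n : ℕ) :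
    Submodule 𝕜 (Tensor W) :=
  Submodule.span 𝕜 {x | ∃ i j a b, i < n ∧ j < n ∧ i + j = n ∧ a ∈ lieOnDeg W U i ∧
    b ∈ lieOnDeg W U j ∧ x = bracket W i j a b}

/-- A monomial of length at least two is a bracket whose factors have positive degree or vanish, so
both degrees are below `n`. This is what makes inductions over the degree run. -/
theorem sub_lin_mem_decomposables {n : ℕ} {x : Tensor W} (hx : x ∈ lieOnDeg W U n) :
    x - ι 𝕜 (lin W x) ∈ decomposables W U n := by
  refine (Submodule.span_le (p := (decomposables W U n).comap
    (LinearMap.id - ι 𝕜 ∘ₗ lin W))).2 ?_ hx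
  rintro x ⟨l, h⟩
  rw [SetLike.mem_coe, Submodule.mem_comap]
  simp only [LinearMap.sub_apply, LinearMap.id_apply, LinearMap.comp_apply]
  rcases h.cases' with ⟨w, hw, rfl, -⟩ | ⟨-, h0, i, j, p, q, a, b, ha, hb, rfl, rfl⟩
  · rw [lin_ι, sub_self]; exact zero_mem _
  · rw [h0, map_zero, sub_zero]
    rcases Nat.eq_zero_or_pos i with rfl | hi
    · rw [ha.eq_zero_of_deg, bracket_zero_left]; exact zero_mem _
    rcases Nat.eq_zero_or_pos j with rfl | hj
    · rw [hb.eq_zero_of_deg, bracket_zero_right]; exact zero_mem _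
    exact Submodule.subset_span ⟨i, j, a, b, by omega, by omega, rfl,
      Submodule.subset_span ⟨p, ha⟩, Submodule.subset_span ⟨q, hb⟩, rfl⟩

theorem lin_of_mem_decomposables {n : ℕ} {x : Tensor W} (hx : x ∈ decomposables W U n) :
    lin W x = 0 := by
  refine (Submodule.span_le (p := LinearMap.ker (lin W))).2 ?_ hx
  rintro _ ⟨i, j, a, b, -, -, -, ha, hb, rfl⟩
  exact lin_bracket (lieOn_le_freeLie (lieOnDeg_le_lieOn _ ha))
    (lieOn_le_freeLie (lieOnDeg_le_lieOn _ hb))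

theorem sub_lin_mem_iSup {x : Tensor W} (hx : x ∈ freeLie W) :
    x - ι 𝕜 (lin W x) ∈ ⨆ (l : ℕ) (_ : 2 ≤ l), freeLieLength W l := by
  refine freeLie_induction (p := (⨆ (l : ℕ) (_ : 2 ≤ l), freeLieLength W l).comap
    (LinearMap.id - ι 𝕜 ∘ₗ lin W)) (fun n l x h => ?_) hx
  rw [Submodule.mem_comap]
  simp only [LinearMap.sub_apply, LinearMap.id_apply, LinearMap.comp_apply]
  rcases h.cases' with ⟨w, hw, rfl, -⟩ | ⟨hl, h0, -⟩
  · rw [lin_ι, sub_self]; exact zero_mem _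
  · rw [h0, map_zero, sub_zero]
    exact (le_iSup₂_of_le (f := fun l (_ : 2 ≤ l) => freeLieLength W l) l hl le_rfl)
      (Submodule.subset_span ⟨n, h⟩)

theorem lin_of_mem_iSup {x : Tensor W}
    (hx : x ∈ ⨆ (l : ℕ) (_ : 2 ≤ l), freeLieLength W l) : lin W x = 0 := by
  refine (iSup₂_le (a := LinearMap.ker (lin W)) fun l hl => Submodule.span_le.2 ?_) hx
  rintro x ⟨n, h⟩
  rcases h.cases' with ⟨w, hw, rfl, rfl⟩ | ⟨-, h, -⟩
  · omega
  · exact h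

theorem sub_lenComp_mem_iSup {x : Tensor W} (hx : x ∈ freeLie W) (m : ℕ) :
    x - lenComp W m x ∈ ⨆ (l : ℕ) (_ : l ≠ m), freeLieLength W l := by
  refine freeLie_induction (p := (⨆ (l : ℕ) (_ : l ≠ m), freeLieLength W l).comap
    (LinearMap.id - lenComp W m)) (fun n l x h => ?_) hx
  rw [Submodule.mem_comap]
  simp only [LinearMap.sub_apply, LinearMap.id_apply, h.lenComp]
  split_ifs with hl
  · rw [sub_self]; exact zero_mem _
  · rw [sub_zero]
    exact (le_iSup₂_of_le (f := fun l (_ : l ≠ m) => freeLieLength W l) l hl le_rfl)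
      (Submodule.subset_span ⟨n, h⟩)

end Lin

/-! ### Derivations of the tensor algebra -/

section Derivations

/-- A subspace of the tensor algebra that contains the generators and is closed under products is
everything. -/
theorem tensor_induction {W : GradedSpace.{u, v} 𝕜} {p : Submodule 𝕜 (Tensor W)} (h1 : 1 ∈ p)
    (hι : ∀ n, ∀ w ∈ W.deg n, ι 𝕜 w ∈ p) (hmul : ∀ x y, x ∈ p → y ∈ p → x * y ∈ p)
    (x : Tensor W) : x ∈ p := by
  induction x using TensorAlgebra.induction with
  | algebraMap r => rw [Algebra.algebraMap_eq_smul_one]; exact p.smul_mem r h1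
  | ι w => exact W.le_of_deg_le (p := p.comap (ι 𝕜)) hι w
  | mul a b ha hb => exact hmul a b ha hb
  | add a b ha hb => exact add_mem ha hb

theorem algHom_ext_deg {W : GradedSpace.{u, v} 𝕜} {A : Type*} [Ring A] [Algebra 𝕜 A]
    {f g : Tensor W →ₐ[𝕜] A} (h : ∀ n, ∀ w ∈ W.deg n, f (ι 𝕜 w) = g (ι 𝕜 w)) : f = g :=
  TensorAlgebra.hom_ext (W.hom_ext h)

variable (W : GradedSpace.{u, v} 𝕜)

/-- The automorphism of the tensor algebra that is `(-1) ^ n` on the elements of degree `n`. -/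
noncomputable def sgn : Tensor W →ₐ[𝕜] Tensor W :=
  TensorAlgebra.lift 𝕜 (W.lift fun n => (-1 : 𝕜) ^ n • (ι 𝕜 ∘ₗ (W.deg n).subtype))

variable {W}

theorem sgn_ι {n : ℕ} {w : W.carrier} (hw : w ∈ W.deg n) :
    sgn W (ι 𝕜 w) = (-1 : 𝕜) ^ n • ι 𝕜 w := by
  simp [sgn, W.lift_apply _ hw]

theorem sgn_sgn (x : Tensor W) : sgn W (sgn W x) = x := by
  have : (sgn W).comp (sgn W) = AlgHom.id 𝕜 _ := algHom_ext_deg fun n w hw => by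
    simp [sgn_ι hw, smul_smul, ← mul_pow]
  exact DFunLike.congr_fun this x

theorem sgn_of_mem {n : ℕ} {x : Tensor W} (hx : x ∈ freeLieDeg W n) :
    sgn W x = (-1 : 𝕜) ^ n • x := by
  refine (Submodule.span_le (p := LinearMap.eqLocus (sgn W).toLinearMap
    ((-1 : 𝕜) ^ n • LinearMap.id))).2 ?_ hx
  clear hx x
  rintro x ⟨l, h⟩
  simp only [SetLike.mem_coe, LinearMap.mem_eqLocus, AlgHom.toLinearMap_apply,
    LinearMap.smul_apply, LinearMap.id_apply]
  induction h with
  | gen _ hw => exact sgn_ι hw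
  | @bracket m n p q a b _ _ iha ihb =>
    simp only [GradedLie.bracket, map_sub, map_smul, map_mul, iha, ihb, smul_mul_smul_comm,
      smul_sub, pow_add]
    rw [smul_comm, mul_comm ((-1 : 𝕜) ^ n)]

/-- A linear endomorphism `D` of the tensor algebra with `D (xy) = ±x D y + (D x) y`, where the
sign is `(-1) ^ n` for `x` of degree `n`. -/
def IsOddDer (D : Tensor W →ₗ[𝕜] Tensor W) : Prop :=
  ∀ x y, D (x * y) = sgn W x * D y + D x * y

theorem IsOddDer.map_one {D : Tensor W →ₗ[𝕜] Tensor W} (hD : IsOddDer D) : D 1 = 0 := by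
  have := hD 1 1
  simpa using this

/-- The matrix representation of the derivation with given values on the generators. -/
noncomputable def derMatrix (g : W.carrier →ₗ[𝕜] Tensor W) :
    Tensor W →ₐ[𝕜] Matrix (Fin 2) (Fin 2) (Tensor W) :=
  TensorAlgebra.lift 𝕜
    { toFun := fun w => !![sgn W (ι 𝕜 w), g w; 0, ι 𝕜 w]
      map_add' := fun x y => by ext i j; fin_cases i <;> fin_cases j <;> simp
      map_smul' := fun c x => by ext i j; fin_cases i <;> fin_cases j <;> simp }

/-- The odd derivation of the tensor algebra with given values on the generators. -/
noncomputable def der (g : W.carrier →ₗ[𝕜] Tensor W) : Tensor W →ₗ[𝕜] Tensor W where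
  toFun x := derMatrix g x 0 1
  map_add' x y := by simp
  map_smul' c x := by simp

theorem der_ι (g : W.carrier →ₗ[𝕜] Tensor W) (w : W.carrier) : der g (ι 𝕜 w) = g w := by
  simp [der, derMatrix]

/-- In a product of upper triangular matrices with diagonals `(sgn x, x)` and `(sgn y, y)`, the
upper right entry obeys the odd Leibniz rule. An algebra map to matrices thus encodes a derivation.
-/
theorem derMatrix_entries (g : W.carrier →ₗ[𝕜] Tensor W) (x : Tensor W) :
    derMatrix g x 0 0 = sgn W x ∧ derMatrix g x 1 0 = 0 ∧ derMatrix g x 1 1 = x := by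
  induction x using TensorAlgebra.induction with
  | algebraMap r => simp [Matrix.algebraMap_matrix_apply]
  | ι w => simp [derMatrix]
  | mul a b ha hb =>
    obtain ⟨ha, ha', ha''⟩ := ha
    obtain ⟨hb, hb', hb''⟩ := hb
    simp [Matrix.mul_apply, Fin.sum_univ_two, ha, ha', ha'', hb, hb', hb'']
  | add a b ha hb =>
    obtain ⟨ha, ha', ha''⟩ := ha
    obtain ⟨hb, hb', hb''⟩ := hb
    simp [ha, ha', ha'', hb, hb', hb'']

theorem der_isOddDer (g : W.carrier →ₗ[𝕜] Tensor W) : IsOddDer (der g) := by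
  intro x y
  simp [der, Matrix.mul_apply, Fin.sum_univ_two, (derMatrix_entries g x).1,
    (derMatrix_entries g y).2.2]

/-- An algebra map that intertwines odd derivations on generators intertwines them. -/
theorem IsOddDer.comm {V : GradedSpace.{u, v} 𝕜} {f : Tensor V →ₐ[𝕜] Tensor W}
    (hf : ∀ x, f (sgn V x) = sgn W (f x)) {d : Tensor V →ₗ[𝕜] Tensor V}
    {D : Tensor W →ₗ[𝕜] Tensor W} (hd : IsOddDer d) (hD : IsOddDer D)
    (h : ∀ n, ∀ v ∈ V.deg n, f (d (ι 𝕜 v)) = D (f (ι 𝕜 v))) (x : Tensor V) :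
    f (d x) = D (f x) := by
  refine tensor_induction (p := LinearMap.eqLocus (f.toLinearMap ∘ₗ d) (D ∘ₗ f.toLinearMap))
    ?_ h ?_ x
  · simp [hd.map_one, hD.map_one]
  · intro x y hx hy
    simp only [LinearMap.mem_eqLocus, LinearMap.comp_apply, AlgHom.toLinearMap_apply] at *
    rw [hd, map_add, map_mul, map_mul, map_mul, hD, hx, hy, hf]

theorem IsOddDer.sgn_comm {D : Tensor W →ₗ[𝕜] Tensor W} (hD : IsOddDer D)
    (h : ∀ n, ∀ w ∈ W.deg n, D (sgn W (ι 𝕜 w)) = - sgn W (D (ι 𝕜 w))) (x : Tensor W) :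
    D (sgn W x) = - sgn W (D x) := by
  refine tensor_induction (p := LinearMap.eqLocus (D ∘ₗ (sgn W).toLinearMap)
    (-((sgn W).toLinearMap ∘ₗ D))) ?_ h ?_ x
  · simp [hD.map_one]
  · intro x y hx hy
    simp only [LinearMap.mem_eqLocus, LinearMap.comp_apply, AlgHom.toLinearMap_apply,
      LinearMap.neg_apply] at *
    rw [map_mul, hD, hD, map_add, map_mul, map_mul, hx, hy, neg_add, mul_neg, neg_mul]

/-- The graded commutator of two odd derivations is a derivation. -/
theorem IsOddDer.comm_mul {D E : Tensor W →ₗ[𝕜] Tensor W} (hD : IsOddDer D) (hE : IsOddDer E)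
    (hD' : ∀ x, D (sgn W x) = - sgn W (D x)) (hE' : ∀ x, E (sgn W x) = - sgn W (E x))
    (x y : Tensor W) :
    (D (E (x * y)) + E (D (x * y))) = x * (D (E y) + E (D y)) + (D (E x) + E (D x)) * y := by
  -- The cross terms of `DE` cancel against those of `ED`, because both maps anticommute with `sgn`.
  rw [hD x y, hE x y, map_add, map_add, hD, hD, hE, hE, hD', hE', sgn_sgn]
  noncomm_ring

/-- The square of an odd derivation is a derivation. -/
theorem IsOddDer.sq_mul {D : Tensor W →ₗ[𝕜] Tensor W} (hD : IsOddDer D)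
    (hD' : ∀ x, D (sgn W x) = - sgn W (D x)) (x y : Tensor W) :
    D (D (x * y)) = x * D (D y) + D (D x) * y := by
  rw [hD x y, map_add, hD, hD, hD', sgn_sgn]
  noncomm_ring

theorem IsOddDer.sq_eq_zero {D : Tensor W →ₗ[𝕜] Tensor W} (hD : IsOddDer D)
    (hD' : ∀ x, D (sgn W x) = - sgn W (D x)) (h : ∀ w, D (D (ι 𝕜 w)) = 0) (x : Tensor W) :
    D (D x) = 0 := by
  refine tensor_induction (p := LinearMap.ker (D ∘ₗ D)) ?_ (fun n w _ => h w) ?_ x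
  · simp [hD.map_one]
  · intro x y hx hy
    simp only [LinearMap.mem_ker, LinearMap.comp_apply] at *
    rw [hD.sq_mul hD', hx, hy, mul_zero, zero_mul, add_zero]

theorem IsOddDer.map_bracket {D : Tensor W →ₗ[𝕜] Tensor W} (hD : IsOddDer D) {i j : ℕ}
    {a b : Tensor W} (ha : a ∈ freeLieDeg W (i + 1)) (hb : b ∈ freeLieDeg W (j + 1)) :
    D (bracket W (i + 1) (j + 1) a b) = bracket W i (j + 1) (D a) b +
      (-1 : 𝕜) ^ (i + 1) • bracket W (i + 1) j a (D b) := by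
  simp only [bracket, map_sub, map_smul, hD a b, hD b a, sgn_of_mem ha,
    sgn_of_mem hb, smul_mul_assoc, smul_sub, smul_add, smul_smul]
  have e1 : (-1 : 𝕜) ^ ((i + 1) * (j + 1)) * (-1) ^ (j + 1) = (-1) ^ (i * (j + 1)) := by
    rw [← pow_add, add_mul, one_mul, add_assoc, pow_add, ← two_mul, pow_mul (-1 : 𝕜) 2]
    simp
  have e2 : (-1 : 𝕜) ^ (i + 1) * (-1) ^ ((i + 1) * j) = (-1) ^ ((i + 1) * (j + 1)) := by
    rw [← pow_add]; congr 1; ring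
  rw [e1, e2]
  abel

/-- An odd derivation of degree `-1` on the generators has degree `-1` on the Lie algebra. -/
theorem IsOddDer.mem_freeLieDeg {D : Tensor W →ₗ[𝕜] Tensor W} (hD : IsOddDer D)
    (h : ∀ n, ∀ w ∈ W.deg (n + 1), D (ι 𝕜 w) ∈ freeLieDeg W n) {n : ℕ} {x : Tensor W}
    (hx : x ∈ freeLieDeg W (n + 1)) : D x ∈ freeLieDeg W n := by
  refine (Submodule.span_le (p := (freeLieDeg W n).comap D)).2 ?_ hx
  clear hx x
  rintro x ⟨l, hx⟩
  rw [SetLike.mem_coe, Submodule.mem_comap]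
  generalize hm : n + 1 = m at hx
  induction hx generalizing n with
  | gen _ hw => subst hm; exact h n _ hw
  | @bracket i j p q a b ha hb iha ihb =>
    rcases i with _ | i
    · rw [ha.eq_zero_of_deg, bracket_zero_left, map_zero]; exact zero_mem _
    rcases j with _ | j
    · rw [hb.eq_zero_of_deg, bracket_zero_right, map_zero]; exact zero_mem _
    have h1 := iha (n := i) rfl
    have h2 := ihb (n := j) rfl
    rw [hD.map_bracket ha.mem_freeLieDeg hb.mem_freeLieDeg]
    have hn : n = i + (j + 1) := by omega
    refine add_mem ?_ (Submodule.smul_mem _ _ ?_)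
    · rw [hn]
      exact bracket_mem_lieOnDeg h1 hb.mem_freeLieDeg
    · rw [show n = (i + 1) + j by omega]
      exact bracket_mem_lieOnDeg ha.mem_freeLieDeg h2

/-- Only the parity of `D` enters the signs, so this is `IsOddDer.map_bracket` again, with the
degrees recorded for a map that raises them. -/
theorem IsOddDer.map_bracket_succ {D : Tensor W →ₗ[𝕜] Tensor W} (hD : IsOddDer D) {i j : ℕ}
    {a b : Tensor W} (ha : a ∈ freeLieDeg W i) (hb : b ∈ freeLieDeg W j) :
    D (bracket W i j a b) = bracket W (i + 1) j (D a) b +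
      (-1 : 𝕜) ^ i • bracket W i (j + 1) a (D b) := by
  simp only [bracket, map_sub, map_smul, hD a b, hD b a, sgn_of_mem ha,
    sgn_of_mem hb, smul_mul_assoc, smul_sub, smul_add, smul_smul]
  have e1 : (-1 : 𝕜) ^ (i * j) * (-1) ^ j = (-1) ^ ((i + 1) * j) := by
    rw [← pow_add]; congr 1; ring
  have e2 : (-1 : 𝕜) ^ i * (-1) ^ (i * (j + 1)) = (-1) ^ (i * j) := by
    rw [← pow_add, mul_add, mul_one, add_comm, add_assoc, pow_add, ← two_mul, pow_mul (-1 : 𝕜) 2]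
    simp
  rw [e1, e2]
  abel

/-- An odd derivation of degree `1` on the generators has degree `1` on the Lie algebra. -/
theorem IsOddDer.mem_freeLieDeg_succ {D : Tensor W →ₗ[𝕜] Tensor W} (hD : IsOddDer D)
    (h : ∀ n, ∀ w ∈ W.deg n, D (ι 𝕜 w) ∈ freeLieDeg W (n + 1)) {n : ℕ} {x : Tensor W}
    (hx : x ∈ freeLieDeg W n) : D x ∈ freeLieDeg W (n + 1) := by
  refine (Submodule.span_le (p := (freeLieDeg W (n + 1)).comap D)).2 ?_ hx
  clear hx x
  rintro x ⟨l, hx⟩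
  rw [SetLike.mem_coe, Submodule.mem_comap]
  induction hx with
  | gen _ hw => exact h _ _ hw
  | @bracket i j p q a b ha hb iha ihb =>
    rw [hD.map_bracket_succ ha.mem_freeLieDeg hb.mem_freeLieDeg]
    refine add_mem ?_ (Submodule.smul_mem _ _ ?_)
    · rw [show i + j + 1 = (i + 1) + j by omega]
      exact bracket_mem_lieOnDeg iha hb.mem_freeLieDeg
    · rw [show i + j + 1 = i + (j + 1) by omega]
      exact bracket_mem_lieOnDeg ha.mem_freeLieDeg ihb

end Derivations

/-! ### Maps of free Lie algebras -/

section LieMaps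

variable {V W X : GradedSpace.{u, v} 𝕜}

/-- An algebra map of tensor algebras that restricts to a morphism of free Lie algebras. -/
def IsLieMap (f : Tensor V →ₐ[𝕜] Tensor W) : Prop :=
  ∀ n, ∀ v ∈ V.deg n, f (ι 𝕜 v) ∈ freeLieDeg W n

theorem map_bracket (f : Tensor V →ₐ[𝕜] Tensor W) (m n : ℕ) (a b : Tensor V) :
    f (bracket V m n a b) = bracket W m n (f a) (f b) := by
  simp [bracket]

theorem map_mem_lieOnDeg {f : Tensor V →ₐ[𝕜] Tensor W} {U : Submodule 𝕜 V.carrier}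
    {U' : Submodule 𝕜 W.carrier} (hf : ∀ n, ∀ v ∈ U ⊓ V.deg n, f (ι 𝕜 v) ∈ lieOnDeg W U' n)
    {n : ℕ} {x : Tensor V} (hx : x ∈ lieOnDeg V U n) : f x ∈ lieOnDeg W U' n := by
  refine (Submodule.span_le (p := (lieOnDeg W U' n).comap f.toLinearMap)).2 ?_ hx
  clear hx x
  rintro x ⟨l, h⟩
  rw [SetLike.mem_coe, Submodule.mem_comap, AlgHom.toLinearMap_apply]
  induction h with
  | gen hU hn => exact hf _ _ ⟨hU, hn⟩
  | bracket _ _ iha ihb => rw [map_bracket]; exact bracket_mem_lieOnDeg iha ihb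

theorem map_mem_lieOn {f : Tensor V →ₐ[𝕜] Tensor W} {U : Submodule 𝕜 V.carrier}
    {U' : Submodule 𝕜 W.carrier} (hf : ∀ n, ∀ v ∈ U ⊓ V.deg n, f (ι 𝕜 v) ∈ lieOnDeg W U' n)
    {x : Tensor V} (hx : x ∈ lieOn V U) : f x ∈ lieOn W U' :=
  freeLie_induction (p := (lieOn W U').comap f.toLinearMap) (fun n l _ h =>
    lieOnDeg_le_lieOn n (map_mem_lieOnDeg hf (Submodule.subset_span ⟨l, h⟩))) hx

namespace IsLieMap

variable {f : Tensor V →ₐ[𝕜] Tensor W}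

theorem mem_deg (hf : IsLieMap f) {n : ℕ} {x : Tensor V} (hx : x ∈ freeLieDeg V n) :
    f x ∈ freeLieDeg W n :=
  map_mem_lieOnDeg (U := ⊤) (U' := ⊤) (fun n v hv => hf n v hv.2) hx

theorem mem (hf : IsLieMap f) {x : Tensor V} (hx : x ∈ freeLie V) : f x ∈ freeLie W :=
  map_mem_lieOn (U := ⊤) (U' := ⊤) (fun n v hv => hf n v hv.2) hx

theorem comp {g : Tensor W →ₐ[𝕜] Tensor X} (hg : IsLieMap g) (hf : IsLieMap f) :
    IsLieMap (g.comp f) := fun n v hv => hg.mem_deg (hf n v hv)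

theorem sgn (hf : IsLieMap f) (x : Tensor V) : f (sgn V x) = GradedLie.sgn W (f x) := by
  have : f.comp (GradedLie.sgn V) = (GradedLie.sgn W).comp f := algHom_ext_deg fun n v hv => by
    simp [sgn_ι hv, sgn_of_mem (hf n v hv)]
  exact DFunLike.congr_fun this x

theorem degComp (hf : IsLieMap f) (n : ℕ) {x : Tensor V} (hx : x ∈ freeLie V) :
    degComp W n (f x) = f (degComp V n x) := by
  refine freeLie_induction (p := LinearMap.eqLocus (GradedLie.degComp W n ∘ₗ f.toLinearMap)
    (f.toLinearMap ∘ₗ GradedLie.degComp V n)) (fun m l x h => ?_) hx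
  simp only [LinearMap.mem_eqLocus, LinearMap.comp_apply, AlgHom.toLinearMap_apply, h.degComp,
    degComp_of_mem (hf.mem_deg h.mem_freeLieDeg)]
  split_ifs <;> simp

end IsLieMap

/-- Brackets go to brackets, which have no linear part. -/
theorem lin_map {f : Tensor V →ₐ[𝕜] Tensor W} (hf : IsLieMap f) {x : Tensor V}
    (hx : x ∈ freeLie V) : lin W (f x) = lin W (f (ι 𝕜 (lin V x))) := by
  refine freeLie_induction (p := LinearMap.eqLocus (lin W ∘ₗ f.toLinearMap)
    (lin W ∘ₗ f.toLinearMap ∘ₗ ι 𝕜 ∘ₗ lin V)) (fun n l x h => ?_) hx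
  simp only [LinearMap.mem_eqLocus, LinearMap.comp_apply, AlgHom.toLinearMap_apply]
  rcases h.cases' with ⟨w, hw, rfl, -⟩ | ⟨-, h0, i, j, p, q, a, b, ha, hb, -, rfl⟩
  · rw [lin_ι]
  · rw [h0, map_zero, map_zero, map_zero, map_bracket]
    exact lin_bracket (hf.mem ha.mem_freeLie) (hf.mem hb.mem_freeLie)

/-- The algebra map of tensor algebras induced by a linear map. -/
noncomputable def tensorMap (g : V.carrier →ₗ[𝕜] W.carrier) : Tensor V →ₐ[𝕜] Tensor W :=
  TensorAlgebra.lift 𝕜 (ι 𝕜 ∘ₗ g)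

@[simp] theorem tensorMap_ι (g : V.carrier →ₗ[𝕜] W.carrier) (v : V.carrier) :
    tensorMap g (ι 𝕜 v) = ι 𝕜 (g v) := by simp [tensorMap]

theorem tensorMap_isLieMap {g : V.carrier →ₗ[𝕜] W.carrier}
    (hg : ∀ n, ∀ v ∈ V.deg n, g v ∈ W.deg n) : IsLieMap (tensorMap g) := fun n v hv => by
  rw [tensorMap_ι]; exact ι_mem_freeLieDeg (hg n v hv)

theorem tensorMap_mem_lieOn {g : V.carrier →ₗ[𝕜] W.carrier}
    (hg : ∀ n, ∀ v ∈ V.deg n, g v ∈ W.deg n) {U : Submodule 𝕜 V.carrier}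
    {U' : Submodule 𝕜 W.carrier} (h : ∀ v ∈ U, g v ∈ U') {x : Tensor V} (hx : x ∈ lieOn V U) :
    tensorMap g x ∈ lieOn W U' :=
  map_mem_lieOn (fun n v hv => by
    rw [tensorMap_ι]; exact ι_mem_lieOnDeg (h v hv.1) (hg n v hv.2)) hx

end LieMaps

/-! ### Differentials and morphisms on the tensor algebra -/

section Extension

variable {V W : GradedSpace.{u, v} 𝕜}

namespace Differential

/-- The extension of a differential to a derivation of the tensor algebra. -/
noncomputable def D (δ : Differential W) : Tensor W →ₗ[𝕜] Tensor W :=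
  der ((freeLie W).subtype ∘ₗ δ.d ∘ₗ gen W)

theorem D_isOddDer (δ : Differential W) : IsOddDer δ.D := der_isOddDer _

theorem D_ι (δ : Differential W) (w : W.carrier) : δ.D (ι 𝕜 w) = δ.d (gen W w) := by
  rw [D, der_ι]; rfl

theorem D_ι_mem (δ : Differential W) {n : ℕ} {w : W.carrier} (hw : w ∈ W.deg (n + 1)) :
    δ.D (ι 𝕜 w) ∈ freeLieDeg W n := by
  rw [D_ι]; exact δ.d_deg n _ (ι_mem_freeLieDeg hw)

theorem D_mem_deg (δ : Differential W) {n : ℕ} {x : Tensor W} (hx : x ∈ freeLieDeg W (n + 1)) :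
    δ.D x ∈ freeLieDeg W n := δ.D_isOddDer.mem_freeLieDeg (fun _ _ hw => δ.D_ι_mem hw) hx

theorem D_coe (δ : Differential W) (x : freeLie W) : δ.D x = δ.d x := by
  obtain ⟨x, hx⟩ := x
  have key : ∀ n l x, IsLieMonomial W ⊤ n l x → ∀ h : x ∈ freeLie W, δ.D x = δ.d ⟨x, h⟩ := by
    intro n l x hx
    induction hx with
    | gen hU hw => intro h; exact δ.D_ι _
    | @bracket i j p q a b ha hb iha ihb =>
      intro h
      rcases i with _ | i
      · have h0 : bracket W 0 j a b = 0 := by rw [ha.eq_zero_of_deg, bracket_zero_left]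
        have : (⟨bracket W 0 j a b, h⟩ : freeLie W) = 0 := Subtype.ext h0
        rw [this, h0, map_zero, map_zero]; rfl
      rcases j with _ | j
      · have h0 : bracket W (i + 1) 0 a b = 0 := by rw [hb.eq_zero_of_deg, bracket_zero_right]
        have : (⟨bracket W (i + 1) 0 a b, h⟩ : freeLie W) = 0 := Subtype.ext h0
        rw [this, h0, map_zero, map_zero]; rfl
      have e := congrArg Subtype.val (δ.d_lie i j ⟨a, ha.mem_freeLie⟩ ⟨b, hb.mem_freeLie⟩
        ha.mem_freeLieDeg hb.mem_freeLieDeg)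
      rw [δ.D_isOddDer.map_bracket ha.mem_freeLieDeg hb.mem_freeLieDeg, iha ha.mem_freeLie,
        ihb hb.mem_freeLie]
      exact e.symm
  -- The induction principle concerns subspaces of the tensor algebra, so the locus of equality
  -- inside `freeLie W` is pushed forward along the inclusion.
  have := freeLie_induction (U := ⊤) (p := ((LinearMap.eqLocus (δ.D ∘ₗ (freeLie W).subtype)
    ((freeLie W).subtype ∘ₗ δ.d))).map (freeLie W).subtype) (fun n l x h =>
      ⟨⟨x, h.mem_freeLie⟩, key n l x h h.mem_freeLie, rfl⟩) hx
  obtain ⟨y, hy, rfl⟩ := this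
  exact hy

theorem D_eq (δ : Differential W) {x : Tensor W} (hx : x ∈ freeLie W) :
    δ.D x = δ.d ⟨x, hx⟩ := δ.D_coe ⟨x, hx⟩

theorem D_mem (δ : Differential W) {x : Tensor W} (hx : x ∈ freeLie W) : δ.D x ∈ freeLie W := by
  rw [δ.D_eq hx]; exact Subtype.property _

theorem D_D (δ : Differential W) {x : Tensor W} (hx : x ∈ freeLie W) : δ.D (δ.D x) = 0 := by
  rw [δ.D_eq hx, δ.D_coe, δ.d_d]; rfl

theorem D_sgn (δ : Differential W) (x : Tensor W) : δ.D (sgn W x) = -sgn W (δ.D x) := by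
  refine δ.D_isOddDer.sgn_comm (fun n w hw => ?_) x
  rcases n with _ | n
  · simp [W.eq_zero_of_deg_zero hw]
  · rw [sgn_ι hw, map_smul, sgn_of_mem (δ.D_ι_mem hw), pow_succ]
    simp

theorem D_degComp (δ : Differential W) (n : ℕ) {x : Tensor W} (hx : x ∈ freeLie W) :
    degComp W n (δ.D x) = δ.D (degComp W (n + 1) x) := by
  refine freeLie_induction (p := LinearMap.eqLocus (degComp W n ∘ₗ δ.D)
    (δ.D ∘ₗ degComp W (n + 1))) (fun m l x h => ?_) hx
  simp only [LinearMap.mem_eqLocus, LinearMap.comp_apply, h.degComp]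
  rcases m with _ | m
  · simp [h.eq_zero_of_deg]
  · rw [degComp_of_mem (δ.D_mem_deg h.mem_freeLieDeg)]
    simp only [add_left_inj]
    split_ifs <;> simp

/-- The differential on `𝕃(W)` with given values on the generators. -/
noncomputable def ofGen (g : W.carrier →ₗ[𝕜] Tensor W)
    (hg : ∀ n, ∀ w ∈ W.deg (n + 1), g w ∈ freeLieDeg W n) (h : ∀ w, der g (g w) = 0) :
    Differential W :=
  have hdeg : ∀ (n : ℕ) (x : Tensor W), x ∈ freeLieDeg W (n + 1) → der g x ∈ freeLieDeg W n :=
    fun n x hx => (der_isOddDer g).mem_freeLieDeg (fun n w hw => by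
      rw [der_ι]; exact hg n w hw) hx
  have hmem : ∀ x ∈ freeLie W, der g x ∈ freeLie W := fun x hx =>
    freeLie_induction (p := (freeLie W).comap (der g)) (fun n l x hx => by
      rcases n with _ | n
      · simp [hx.eq_zero_of_deg]
      · exact freeLieDeg_le_freeLie n (hdeg n x hx.mem_freeLieDeg)) hx
  { d := (der g).restrict hmem
    d_deg := fun n a ha => hdeg n a ha
    d_lie := fun m n a b ha hb => Subtype.ext ((der_isOddDer g).map_bracket ha hb)
    d_d := fun a => Subtype.ext <| (der_isOddDer g).sq_eq_zero
      ((der_isOddDer g).sgn_comm fun n w hw => by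
        rcases n with _ | n
        · simp [W.eq_zero_of_deg_zero hw]
        · rw [sgn_ι hw, map_smul, der_ι, sgn_of_mem (hg n w hw), pow_succ]
          simp) (fun w => by rw [der_ι, h]) a }

theorem ofGen_D_ι (g : W.carrier →ₗ[𝕜] Tensor W)
    (hg : ∀ n, ∀ w ∈ W.deg (n + 1), g w ∈ freeLieDeg W n) (h : ∀ w, der g (g w) = 0)
    (w : W.carrier) : (ofGen g hg h).D (ι 𝕜 w) = g w := by
  rw [D_ι]
  exact der_ι g w

end Differential

namespace Hom

variable {d : Differential V} {δ : Differential W}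

/-- The extension of a morphism of dgl's to the tensor algebras. -/
noncomputable def tensor (φ : Hom d δ) : Tensor V →ₐ[𝕜] Tensor W :=
  TensorAlgebra.lift 𝕜 ((freeLie W).subtype ∘ₗ φ.toFun ∘ₗ gen V)

theorem tensor_ι (φ : Hom d δ) (v : V.carrier) : φ.tensor (ι 𝕜 v) = φ.toFun (gen V v) := by
  simp [tensor]

theorem tensor_isLieMap (φ : Hom d δ) : IsLieMap φ.tensor := fun n v hv => by
  rw [tensor_ι]
  exact φ.map_deg n _ (ι_mem_freeLieDeg hv)

theorem tensor_coe (φ : Hom d δ) (x : freeLie V) : φ.tensor x = φ.toFun x := by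
  obtain ⟨x, hx⟩ := x
  have key : ∀ n l x, IsLieMonomial V ⊤ n l x → ∀ h : x ∈ freeLie V,
      φ.tensor x = φ.toFun ⟨x, h⟩ := by
    intro n l x hx
    induction hx with
    | gen hU hw => intro h; exact φ.tensor_ι _
    | @bracket i j p q a b ha hb iha ihb =>
      intro h
      have e := congrArg Subtype.val (φ.map_lie i j ⟨a, ha.mem_freeLie⟩ ⟨b, hb.mem_freeLie⟩
        ha.mem_freeLieDeg hb.mem_freeLieDeg)
      rw [map_bracket, iha ha.mem_freeLie, ihb hb.mem_freeLie]
      exact e.symm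
  have := freeLie_induction (U := ⊤)
    (p := ((LinearMap.eqLocus (φ.tensor.toLinearMap ∘ₗ (freeLie V).subtype)
      ((freeLie W).subtype ∘ₗ φ.toFun))).map (freeLie V).subtype) (fun n l x h =>
      ⟨⟨x, h.mem_freeLie⟩, key n l x h h.mem_freeLie, rfl⟩) hx
  obtain ⟨y, hy, rfl⟩ := this
  exact hy

theorem tensor_D (φ : Hom d δ) (x : Tensor V) : φ.tensor (d.D x) = δ.D (φ.tensor x) :=
  d.D_isOddDer.comm φ.tensor_isLieMap.sgn δ.D_isOddDer (fun n v _ => by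
    rw [d.D_ι, φ.tensor_ι, φ.tensor_coe, δ.D_coe, φ.map_d]) x

/-- The morphism of dgl's that is the restriction of an algebra map of tensor algebras. -/
def ofTensor (f : Tensor V →ₐ[𝕜] Tensor W) (hf : IsLieMap f)
    (h : ∀ x, f (d.D x) = δ.D (f x)) : Hom d δ where
  toFun := f.toLinearMap.restrict (p := freeLie V) (q := freeLie W) fun _ hx => hf.mem hx
  map_deg n a ha := hf.mem_deg ha
  map_lie m n a b ha hb := Subtype.ext (map_bracket f m n a b)
  map_d a := Subtype.ext (by
    have h1 : f (d.D a) = δ.D (f a) := h a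
    rw [d.D_coe, δ.D_eq (hf.mem a.2)] at h1
    exact h1)

theorem ofTensor_coe (f : Tensor V →ₐ[𝕜] Tensor W) (hf : IsLieMap f)
    (h : ∀ x, f (d.D x) = δ.D (f x)) (x : freeLie V) :
    ((ofTensor f hf h : Hom d δ).toFun x : Tensor W) = f x := rfl

/-- Quasi-isomorphisms, in terms of elements. -/
theorem homologyMap_bijective_iff (φ : Hom d δ) : Function.Bijective φ.homologyMap ↔
    (∀ x : freeLie V, d.d x = 0 → (∃ y, φ.toFun x = δ.d y) → ∃ z, x = d.d z) ∧
    (∀ y : freeLie W, δ.d y = 0 → ∃ x, d.d x = 0 ∧ ∃ z, y = φ.toFun x + δ.d z) := by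
  constructor
  · rintro ⟨hi, hs⟩
    constructor
    · rintro x hx ⟨y, hy⟩
      have h0 : φ.homologyMap (Submodule.Quotient.mk ⟨x, hx⟩) = 0 := by
        rw [homologyMap, Submodule.mapQ_apply, Submodule.Quotient.mk_eq_zero]
        exact ⟨y, hy.symm⟩
      rw [← map_zero φ.homologyMap] at h0
      have h1 := hi h0
      rw [Submodule.Quotient.mk_eq_zero] at h1
      obtain ⟨z, hz⟩ := h1
      exact ⟨z, hz.symm⟩
    · intro y hy
      obtain ⟨q, hq⟩ := hs (Submodule.Quotient.mk ⟨y, hy⟩)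
      obtain ⟨⟨x, hx⟩, rfl⟩ := Submodule.Quotient.mk_surjective _ q
      rw [homologyMap, Submodule.mapQ_apply] at hq
      have h1 := (Submodule.Quotient.eq _).1 hq.symm
      obtain ⟨z, hz⟩ := h1
      refine ⟨x, hx, z, ?_⟩
      have hz' : δ.d z = y - φ.toFun x := hz.trans (map_sub (LinearMap.ker δ.d).subtype _ _)
      rw [hz']; abel
  · rintro ⟨hi, hs⟩
    constructor
    · rw [injective_iff_map_eq_zero]
      intro q hq
      obtain ⟨⟨x, hx⟩, rfl⟩ := Submodule.Quotient.mk_surjective _ q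
      rw [homologyMap, Submodule.mapQ_apply, Submodule.Quotient.mk_eq_zero] at hq
      obtain ⟨y, hy⟩ := hq
      obtain ⟨z, hz⟩ := hi x hx ⟨y, hy.symm⟩
      rw [Submodule.Quotient.mk_eq_zero]
      exact ⟨z, hz.symm⟩
    · intro q
      obtain ⟨⟨y, hy⟩, rfl⟩ := Submodule.Quotient.mk_surjective _ q
      obtain ⟨x, hx, z, hz⟩ := hs y hy
      refine ⟨Submodule.Quotient.mk ⟨x, hx⟩, ?_⟩
      rw [homologyMap, Submodule.mapQ_apply]
      refine ((Submodule.Quotient.eq _).2 ?_).symm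
      refine ⟨z, ?_⟩
      refine Eq.trans ?_ (map_sub (LinearMap.ker δ.d).subtype _ _).symm
      change δ.d z = y - φ.toFun x
      rw [hz]; abel

end Hom

/-- The algebra map `f` induces an isomorphism in homology of the free Lie algebras. -/
def IsQuasiIso (d : Differential V) (δ : Differential W) (f : Tensor V →ₐ[𝕜] Tensor W) : Prop :=
  (∀ x ∈ freeLie V, d.D x = 0 → ∀ y ∈ freeLie W, f x = δ.D y → ∃ z ∈ freeLie V, x = d.D z) ∧
  (∀ y ∈ freeLie W, δ.D y = 0 → ∃ x ∈ freeLie V, d.D x = 0 ∧ ∃ z ∈ freeLie W, y = f x + δ.D z)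

theorem Hom.isQuasiIso {d : Differential V} {δ : Differential W} {φ : Hom d δ}
    (h : Function.Bijective φ.homologyMap) : IsQuasiIso d δ φ.tensor := by
  obtain ⟨hi, hs⟩ := φ.homologyMap_bijective_iff.1 h
  constructor
  · intro x hx hdx y hy hxy
    obtain ⟨z, hz⟩ := hi ⟨x, hx⟩ (Subtype.ext (by rw [← d.D_eq hx, hdx]; rfl))
      ⟨⟨y, hy⟩, Subtype.ext (by rw [← δ.D_eq hy, ← hxy, ← φ.tensor_coe])⟩
    exact ⟨z, z.2, by rw [d.D_coe, ← hz]⟩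
  · intro y hy hdy
    obtain ⟨x, hx, z, hz⟩ := hs ⟨y, hy⟩ (Subtype.ext (by rw [← δ.D_eq hy, hdy]; rfl))
    refine ⟨x, x.2, by rw [d.D_coe, hx]; rfl, z, z.2, ?_⟩
    rw [φ.tensor_coe, δ.D_coe]
    exact congrArg Subtype.val hz

theorem IsQuasiIso.ofTensor {d : Differential V} {δ : Differential W}
    {f : Tensor V →ₐ[𝕜] Tensor W} {hf : IsLieMap f} {h : ∀ x, f (d.D x) = δ.D (f x)}
    (hq : IsQuasiIso d δ f) : Function.Bijective (Hom.ofTensor f hf h).homologyMap := by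
  refine (Hom.homologyMap_bijective_iff _).2 ⟨?_, ?_⟩
  · rintro x hx ⟨y, hy⟩
    obtain ⟨z, hz, e⟩ := hq.1 x x.2 (by rw [d.D_coe, hx]; rfl) y y.2 (by
      rw [δ.D_coe, ← hy, Hom.ofTensor_coe])
    exact ⟨⟨z, hz⟩, Subtype.ext (by rw [e, d.D_eq hz])⟩
  · rintro y hy
    obtain ⟨x, hx, hdx, z, hz, e⟩ := hq.2 y y.2 (by rw [δ.D_coe, hy]; rfl)
    refine ⟨⟨x, hx⟩, Subtype.ext (by rw [← d.D_eq hx, hdx]; rfl), ⟨z, hz⟩, Subtype.ext ?_⟩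
    rw [e, Submodule.coe_add, Hom.ofTensor_coe, δ.D_eq hz]

/-- An element of `𝕃(W)` without linear part is a sum of components of length at least two, and
conversely. -/
theorem isMinimal_iff (δ : Differential W) :
    δ.IsMinimal ↔ ∀ w, lin W (δ.D (ι 𝕜 w)) = 0 := by
  refine forall_congr' fun w => ⟨fun h => ?_, fun h => ?_⟩
  · rw [δ.D_ι]; exact lin_of_mem_iSup h
  · have := sub_lin_mem_iSup (δ.D_mem (ι_mem_freeLie W w))
    rwa [h, map_zero, sub_zero, δ.D_ι] at this

/-- A derivation sends brackets to sums of brackets. In particular `w ↦ lin W (δ.D (ι 𝕜 w))` squares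
to zero, and in the minimal case boundaries have no linear part. -/
theorem Differential.lin_D (δ : Differential W) {x : Tensor W} (hx : x ∈ freeLie W) :
    lin W (δ.D x) = lin W (δ.D (ι 𝕜 (lin W x))) := by
  refine freeLie_induction (p := LinearMap.eqLocus (lin W ∘ₗ δ.D)
    (lin W ∘ₗ δ.D ∘ₗ ι 𝕜 ∘ₗ lin W)) (fun n l x h => ?_) hx
  simp only [LinearMap.mem_eqLocus, LinearMap.comp_apply]
  rcases h.cases' with ⟨w, hw, rfl, -⟩ | ⟨-, h0, i, j, p, q, a, b, ha, hb, -, rfl⟩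
  · rw [lin_ι]
  · rw [h0, map_zero, map_zero, map_zero]
    rcases i with _ | i
    · rw [ha.eq_zero_of_deg, bracket_zero_left, map_zero, map_zero]
    rcases j with _ | j
    · rw [hb.eq_zero_of_deg, bracket_zero_right, map_zero, map_zero]
    rw [δ.D_isOddDer.map_bracket ha.mem_freeLieDeg hb.mem_freeLieDeg, map_add, map_smul,
      lin_bracket (δ.D_mem ha.mem_freeLie) hb.mem_freeLie,
      lin_bracket ha.mem_freeLie (δ.D_mem hb.mem_freeLie), smul_zero, add_zero]

end Extension

/-! ### Maps with bijective linear part -/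

section LinearPart

variable {V W : GradedSpace.{u, v} 𝕜} {f : Tensor V →ₐ[𝕜] Tensor W}

theorem decomposables_le_lieOnDeg {U : Submodule 𝕜 W.carrier} (n : ℕ) :
    decomposables W U n ≤ lieOnDeg W U n := by
  refine Submodule.span_le.2 ?_
  rintro _ ⟨i, j, a, b, -, -, rfl, ha, hb, rfl⟩
  exact bracket_mem_lieOnDeg ha hb

theorem decomposables_le_map {U : Submodule 𝕜 V.carrier} {U' : Submodule 𝕜 W.carrier} {n : ℕ}
    (h : ∀ i < n, lieOnDeg W U' i ≤ (lieOnDeg V U i).map f.toLinearMap) :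
    decomposables W U' n ≤ (decomposables V U n).map f.toLinearMap := by
  refine Submodule.span_le.2 ?_
  rintro _ ⟨i, j, a, b, hi, hj, hij, ha, hb, rfl⟩
  obtain ⟨a', ha', rfl⟩ := h i hi ha
  obtain ⟨b', hb', rfl⟩ := h j hj hb
  exact ⟨bracket V i j a' b', Submodule.subset_span ⟨i, j, a', b', hi, hj, hij, ha', hb', rfl⟩,
    map_bracket f i j a' b'⟩

/-- A map of free Lie algebras that is surjective on the linear parts is surjective. -/
theorem lieOnDeg_le_map {U : Submodule 𝕜 V.carrier} {U' : Submodule 𝕜 W.carrier} {Q : ℕ → Prop}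
    (hQ : ∀ m n, m ≤ n → Q n → Q m)
    (hf : ∀ n, ∀ v ∈ U ⊓ V.deg n, f (ι 𝕜 v) ∈ lieOnDeg W U' n)
    (hs : ∀ n, Q n → ∀ w ∈ U' ⊓ W.deg n, ∃ v ∈ U ⊓ V.deg n, lin W (f (ι 𝕜 v)) = w)
    (n : ℕ) (hn : Q n) : lieOnDeg W U' n ≤ (lieOnDeg V U n).map f.toLinearMap := by
  induction n using Nat.strong_induction_on with
  | _ n ih =>
    have hd := (decomposables_le_map (f := f) fun i hi => ih i hi (hQ i n hi.le hn)).trans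
      (Submodule.map_mono (decomposables_le_lieOnDeg n))
    intro x hx
    obtain ⟨v, hv, hvx⟩ := hs n hn _ (lin_mem_deg hx)
    -- After subtracting the image of a generator with the same linear part, only decomposables
    -- remain, and the induction hypothesis lifts their factors.
    have e : x = f.toLinearMap (ι 𝕜 v) + (x - ι 𝕜 (lin W x)) -
        (f (ι 𝕜 v) - ι 𝕜 (lin W (f (ι 𝕜 v)))) := by
      rw [hvx, AlgHom.toLinearMap_apply]; abel
    rw [e]
    exact sub_mem (add_mem (Submodule.mem_map_of_mem (ι_mem_lieOnDeg hv.1 hv.2))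
      (hd (sub_lin_mem_decomposables hx))) (hd (sub_lin_mem_decomposables (hf n v hv)))

/-- The linear part of `f` is bijective in degree `n`. -/
def LinBijective (f : Tensor V →ₐ[𝕜] Tensor W) (n : ℕ) : Prop :=
  (∀ v ∈ V.deg n, lin W (f (ι 𝕜 v)) = 0 → v = 0) ∧
    ∀ w ∈ W.deg n, ∃ v ∈ V.deg n, lin W (f (ι 𝕜 v)) = w

/-- A map of free Lie algebras whose linear part is bijective in low degrees is invertible in
low degrees. -/
theorem exists_inverse (hf : IsLieMap f) {Q : ℕ → Prop} (hQ : ∀ m n, m ≤ n → Q n → Q m)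
    (hb : ∀ n, Q n → LinBijective f n) : ∃ g : Tensor W →ₐ[𝕜] Tensor V, IsLieMap g ∧
      ∀ n, Q n → (∀ x ∈ freeLieDeg W n, f (g x) = x) ∧ ∀ x ∈ freeLieDeg V n, g (f x) = x := by
  have hsurj : ∀ n, Q n → freeLieDeg W n ≤ (freeLieDeg V n).map f.toLinearMap :=
    lieOnDeg_le_map (U := ⊤) (U' := ⊤) hQ (fun n v hv => hf n v hv.2) fun n hn w hw => by
      obtain ⟨v, hv, e⟩ := (hb n hn).2 w hw.2
      exact ⟨v, ⟨trivial, hv⟩, e⟩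
  -- In the degrees allowed by `Q`, a linear right inverse of `f` is restricted to the generators;
  -- elsewhere `g` may vanish on generators.
  have hr : ∀ n, ∃ r : W.deg n →ₗ[𝕜] Tensor V, (∀ w, r w ∈ freeLieDeg V n) ∧
      (Q n → ∀ w, f (r w) = ι 𝕜 (w : W.carrier)) := by
    intro n
    by_cases hn : Q n
    · let F : freeLieDeg V n →ₗ[𝕜] freeLieDeg W n :=
        f.toLinearMap.restrict fun x hx => hf.mem_deg hx
      have hF : LinearMap.range F = ⊤ := by
        rw [LinearMap.range_eq_top]
        rintro ⟨y, hy⟩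
        obtain ⟨x, hx, e⟩ := hsurj n hn hy
        exact ⟨⟨x, hx⟩, Subtype.ext e⟩
      obtain ⟨r, hr⟩ := F.exists_rightInverse_of_surjective hF
      refine ⟨(freeLieDeg V n).subtype ∘ₗ r ∘ₗ
        (ι 𝕜 ∘ₗ (W.deg n).subtype).codRestrict (freeLieDeg W n)
          (fun w => ι_mem_freeLieDeg w.2), fun w => Subtype.property _, fun _ w => ?_⟩
      exact congrArg Subtype.val (LinearMap.congr_fun hr ⟨ι 𝕜 w, ι_mem_freeLieDeg w.2⟩)
    · exact ⟨0, fun w => zero_mem _, fun h => absurd h hn⟩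
  choose r hr hr' using hr
  let g : Tensor W →ₐ[𝕜] Tensor V := TensorAlgebra.lift 𝕜 (W.lift r)
  have hgι : ∀ n w (hw : w ∈ W.deg n), g (ι 𝕜 w) = r n ⟨w, hw⟩ := fun n w hw => by
    simp [g, W.lift_apply _ hw]
  have hg : IsLieMap g := fun n w hw => by rw [hgι n w hw]; exact hr n _
  have hfg : ∀ n, Q n → ∀ x ∈ freeLieDeg W n, f (g x) = x := by
    intro n hn x hx
    refine (Submodule.span_le (p := LinearMap.eqLocus (f.toLinearMap ∘ₗ g.toLinearMap)
      LinearMap.id)).2 ?_ hx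
    clear hx x
    rintro x ⟨l, hx⟩
    simp only [SetLike.mem_coe, LinearMap.mem_eqLocus, LinearMap.comp_apply,
      AlgHom.toLinearMap_apply, LinearMap.id_apply]
    induction hx with
    | gen _ hw => rw [hgι _ _ hw, hr' _ hn]
    | @bracket i j p q a b ha hb iha ihb =>
      rw [map_bracket, map_bracket, iha (hQ _ _ (by omega) hn), ihb (hQ _ _ (by omega) hn)]
  refine ⟨g, hg, fun n hn => ⟨hfg n hn, fun x hx => ?_⟩⟩
  -- `g` is surjective too in these degrees, since its linear part inverts that of `f`; a surjective
  -- right inverse is a two-sided inverse.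
  have hgs : freeLieDeg V n ≤ (freeLieDeg W n).map g.toLinearMap := by
    refine lieOnDeg_le_map (U := ⊤) (U' := ⊤) hQ (fun n v hv => hg n v hv.2)
      (fun n hn v hv => ?_) n hn
    refine ⟨lin W (f (ι 𝕜 v)), lin_mem_deg (hf n v hv.2), ?_⟩
    have hw := (lin_mem_deg (U := ⊤) (hf n v hv.2)).2
    set w := lin W (f (ι 𝕜 v)) with hw_def
    have h1 : lin W (f (ι 𝕜 (lin V (g (ι 𝕜 w))))) = w := by
      rw [← lin_map hf (hg.mem (ι_mem_freeLie W w)), hfg n hn _ (ι_mem_freeLieDeg hw), lin_ι]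
    refine sub_eq_zero.1 ((hb n hn).1 _ (sub_mem (lin_mem_deg (U := ⊤) (hg n w hw)).2 hv.2) ?_)
    rw [map_sub, map_sub, map_sub, h1, sub_self]
  obtain ⟨y, hy, rfl⟩ := hgs hx
  rw [AlgHom.toLinearMap_apply, hfg n hn y hy]

theorem exists_inverse_of_forall (hf : IsLieMap f) (hb : ∀ n, LinBijective f n) :
    ∃ g : Tensor W →ₐ[𝕜] Tensor V, IsLieMap g ∧ (∀ x, f (g x) = x) ∧ ∀ x, g (f x) = x := by
  obtain ⟨g, hg, h⟩ := exists_inverse hf (Q := fun _ => True) (fun _ _ _ _ => trivial)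
    fun n _ => hb n
  refine ⟨g, hg, fun x => ?_, fun x => ?_⟩
  · have : f.comp g = AlgHom.id 𝕜 _ := algHom_ext_deg fun n w hw =>
      (h n trivial).1 _ (ι_mem_freeLieDeg hw)
    exact DFunLike.congr_fun this x
  · have : g.comp f = AlgHom.id 𝕜 _ := algHom_ext_deg fun n w hw =>
      (h n trivial).2 _ (ι_mem_freeLieDeg hw)
    exact DFunLike.congr_fun this x

/-- A quasi-isomorphism between minimal dgl's is bijective on the generators. -/
theorem IsQuasiIso.linBijective {d : Differential V} {δ : Differential W} (hf : IsLieMap f)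
    (hfd : ∀ x, f (d.D x) = δ.D (f x)) (hq : IsQuasiIso d δ f) (hd : d.IsMinimal)
    (hδ : δ.IsMinimal) (n : ℕ) : LinBijective f n := by
  rw [isMinimal_iff] at hd hδ
  induction n using Nat.strong_induction_on with
  | _ n ih =>
    -- By induction `f` is an isomorphism of the whole Lie algebras below degree `n`.
    obtain ⟨g, hg, h⟩ := exists_inverse hf (Q := fun m => m < n)
      (fun _ _ h h' => lt_of_le_of_lt h h') ih
    rcases n with _ | n
    · refine ⟨fun v hv _ => V.eq_zero_of_deg_zero hv, fun w hw => ⟨0, zero_mem _, ?_⟩⟩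
      simp [W.eq_zero_of_deg_zero hw]
    have hinj : ∀ x ∈ freeLieDeg V n, f (d.D x) = 0 → d.D x = 0 := by
      intro x hx h0
      rcases n with _ | n
      · rw [freeLieDeg_zero, Submodule.mem_bot] at hx
        rw [hx, map_zero]
      · rw [← (h n (by omega)).2 _ (d.D_mem_deg hx), h0, map_zero]
    have hinj' : ∀ x ∈ freeLieDeg V n, f x = 0 → x = 0 := fun x hx h0 => by
      rw [← (h n (by omega)).2 _ hx, h0, map_zero]
    constructor
    -- Here `f v` is decomposable, hence `f v = f y` with `y` decomposable. The difference `v - y`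
    -- is a cycle with image zero, hence a boundary, and by minimality its linear part `v` vanishes.
    · intro v hv hv0
      have h1 := sub_lin_mem_decomposables (U := ⊤) (hf _ v hv)
      rw [hv0, map_zero, sub_zero] at h1
      obtain ⟨y, hy, hyv⟩ := decomposables_le_map (f := f) (U := ⊤) (fun i hi x hx =>
        ⟨g x, hg.mem_deg hx, (h i hi).1 x hx⟩) h1
      rw [AlgHom.toLinearMap_apply] at hyv
      have hu : ι 𝕜 v - y ∈ freeLieDeg V (n + 1) :=
        sub_mem (ι_mem_freeLieDeg hv) (decomposables_le_lieOnDeg _ hy)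
      have hfu : f (ι 𝕜 v - y) = 0 := by rw [map_sub, hyv, sub_self]
      have hdu : d.D (ι 𝕜 v - y) = 0 :=
        hinj' _ (d.D_mem_deg hu) (by rw [hfd, hfu, map_zero])
      obtain ⟨z, hz, e⟩ := hq.1 _ (freeLieDeg_le_freeLie _ hu) hdu 0 (zero_mem _)
        (by rw [hfu, map_zero])
      have := congrArg (lin V) e
      rwa [map_sub, lin_ι, lin_of_mem_decomposables hy, sub_zero, d.lin_D hz, hd] at this
    -- The cycle `y = g (δ w)` bounds some `x`, because `f y = δ w` is a boundary. Then `w - f x` is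
    -- a cycle, homologous to some `f x'`, and boundaries have no linear part: `x + x'` has the
    -- required one.
    · intro w hw
      have hw' := ι_mem_freeLieDeg hw
      have hδw := δ.D_mem_deg hw'
      have hfy := (h n (by omega)).1 _ hδw
      have hy := hg.mem_deg hδw
      set y := g (δ.D (ι 𝕜 w)) with hy_def
      have hdy : d.D y = 0 := hinj y hy (by
        rw [hfd, hfy, δ.D_D (ι_mem_freeLie W w)])
      obtain ⟨z, hz, e⟩ := hq.1 y (freeLieDeg_le_freeLie _ hy) hdy _ (ι_mem_freeLie W w) hfy
      have hx : degComp V (n + 1) z ∈ freeLieDeg V (n + 1) := degComp_mem_lieOnDeg _ hz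
      have hdx : d.D (degComp V (n + 1) z) = y := by
        rw [← d.D_degComp n hz, ← e, degComp_of_mem hy, if_pos rfl]
      set x := degComp V (n + 1) z
      have hm : ι 𝕜 w - f x ∈ freeLieDeg W (n + 1) := sub_mem hw' (hf.mem_deg hx)
      obtain ⟨x', hx', -, z', hz', e'⟩ := hq.2 (ι 𝕜 w - f x) (freeLieDeg_le_freeLie _ hm)
        (by rw [map_sub, ← hfd, hdx, hfy, sub_self])
      have hx'' : degComp V (n + 1) x' ∈ freeLieDeg V (n + 1) := degComp_mem_lieOnDeg _ hx'
      have hz'' : degComp W (n + 1 + 1) z' ∈ freeLieDeg W (n + 1 + 1) :=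
        degComp_mem_lieOnDeg _ hz'
      have e2 := congrArg (degComp W (n + 1)) e'
      rw [degComp_of_mem hm, if_pos rfl, map_add, hf.degComp _ hx', δ.D_degComp _ hz'] at e2
      have e3 := congrArg (lin W) e2
      rw [map_sub, lin_ι, map_add, δ.lin_D (freeLieDeg_le_freeLie _ hz''), hδ, add_zero,
        lin_map hf (freeLieDeg_le_freeLie _ hx), lin_map hf (freeLieDeg_le_freeLie _ hx'')] at e3
      refine ⟨lin V (degComp V (n + 1) x') + lin V x,
        add_mem (lin_mem_deg (U := ⊤) hx'').2 (lin_mem_deg (U := ⊤) hx).2, ?_⟩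
      rw [map_add, map_add, map_add, ← e3, sub_add_cancel]

end LinearPart

/-! ### Quadratic parts -/

section Quadratic

variable {V W : GradedSpace.{u, v} 𝕜}

theorem lenComp_mul_of_lt {a b : Tensor W} {l m : ℕ} (ha : ∀ j < l, lenComp W j a = 0)
    (hb : ∀ j < m, lenComp W j b = 0) {j : ℕ} (hj : j < l + m) : lenComp W j (a * b) = 0 := by
  rw [lenComp_apply, map_mul, coeff_mul]
  refine Finset.sum_eq_zero fun p hp => ?_
  rw [Finset.HasAntidiagonal.mem_antidiagonal] at hp
  rcases lt_or_ge p.1 l with h | h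
  · have := ha _ h
    rw [lenComp_apply] at this
    rw [this, zero_mul]
  · have := hb p.2 (by omega)
    rw [lenComp_apply] at this
    rw [this, mul_zero]

/-- Every other term of the convolution has a factor of length below its bound, so the lowest
components multiply. -/
theorem lenComp_mul {a b : Tensor W} {l m : ℕ} (ha : ∀ j < l, lenComp W j a = 0)
    (hb : ∀ j < m, lenComp W j b = 0) :
    lenComp W (l + m) (a * b) = lenComp W l a * lenComp W m b := by
  rw [lenComp_apply, map_mul, coeff_mul, Finset.sum_eq_single (l, m)]
  · rfl
  · intro p hp hne
    rw [Finset.HasAntidiagonal.mem_antidiagonal] at hp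
    rcases lt_or_ge p.1 l with h | h
    · have := ha _ h
      rw [lenComp_apply] at this
      rw [this, zero_mul]
    · have := hb p.2 (by
        by_contra h'
        exact hne (Prod.ext (by simp; omega) (by simp; omega)))
      rw [lenComp_apply] at this
      rw [this, mul_zero]
  · intro h
    simp at h

theorem lenComp_one {x : Tensor W} (hx : x ∈ freeLie W) : lenComp W 1 x = ι 𝕜 (lin W x) := by
  refine freeLie_induction (p := LinearMap.eqLocus (lenComp W 1) (ι 𝕜 ∘ₗ lin W))
    (fun n l x h => ?_) hx
  rw [LinearMap.mem_eqLocus, LinearMap.comp_apply, h.lenComp]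
  rcases h.cases' with ⟨w, hw, rfl, rfl⟩ | ⟨hl, h0, -⟩
  · simp
  · rw [if_neg (by omega), h0, map_zero]

theorem lenComp_zero {x : Tensor W} (hx : x ∈ freeLie W) : lenComp W 0 x = 0 := by
  refine freeLie_induction (p := LinearMap.ker (lenComp W 0)) (fun n l x h => ?_) hx
  have := h.length_pos
  rw [LinearMap.mem_ker, h.lenComp, if_neg (by omega)]

/-- The leading term of the value of a minimal derivation on a Lie monomial. -/
theorem leadingTerm_der {D E : Tensor W →ₗ[𝕜] Tensor W} (hD : IsOddDer D)
    (hE : IsOddDer E) (h : ∀ w, ∀ j < 2, lenComp W j (D (ι 𝕜 w)) = 0)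
    (h2 : ∀ w, lenComp W 2 (D (ι 𝕜 w)) = E (ι 𝕜 w)) {U : Submodule 𝕜 W.carrier} {n l : ℕ}
    {x : Tensor W} (hx : IsLieMonomial W U n l x) :
    (∀ j < l + 1, lenComp W j (D x) = 0) ∧ lenComp W (l + 1) (D x) = E x := by
  induction hx with
  | gen => exact ⟨fun j hj => h _ j hj, h2 _⟩
  | @bracket m n p q a b ha hb iha ihb =>
    -- Leading terms are multiplicative, so the claim is settled for products and then used for both
    -- `a * b` and `b * a`.
    have key : ∀ {m n p q : ℕ} {a b : Tensor W}, IsLieMonomial W U m p a →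
        IsLieMonomial W U n q b →
        ((∀ j < p + 1, lenComp W j (D a) = 0) ∧ lenComp W (p + 1) (D a) = E a) →
        ((∀ j < q + 1, lenComp W j (D b) = 0) ∧ lenComp W (q + 1) (D b) = E b) →
        (∀ j < p + q + 1, lenComp W j (D (a * b)) = 0) ∧
          lenComp W (p + q + 1) (D (a * b)) = E (a * b) := by
      intro m n p q a b ha hb iha ihb
      have ha' : ∀ j < p, lenComp W j a = 0 := fun j hj => by
        rw [ha.lenComp, if_neg (by omega)]
      have hb' : ∀ j < q, lenComp W j b = 0 := fun j hj => by
        rw [hb.lenComp, if_neg (by omega)]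
      constructor
      · intro j hj
        rw [hD, sgn_of_mem ha.mem_freeLieDeg, smul_mul_assoc, map_add, map_smul,
          lenComp_mul_of_lt ha' ihb.1 (by omega), lenComp_mul_of_lt iha.1 hb' (by omega),
          smul_zero, add_zero]
      · have e1 := lenComp_mul ha' ihb.1
        have e2 := lenComp_mul iha.1 hb'
        rw [hD, hE, sgn_of_mem ha.mem_freeLieDeg, smul_mul_assoc, smul_mul_assoc, map_add,
          map_smul, show p + q + 1 = p + (q + 1) by omega, e1,
          show p + (q + 1) = p + 1 + q by omega, e2, iha.2, ihb.2, ha.lenComp, hb.lenComp,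
          if_pos rfl, if_pos rfl]
    obtain ⟨h1, h1'⟩ := key ha hb iha ihb
    obtain ⟨h2, h2'⟩ := key hb ha ihb iha
    rw [add_comm q p] at h2 h2'
    refine ⟨fun j hj => ?_, ?_⟩
    · rw [bracket, map_sub, map_sub, map_smul, map_smul, h1 j hj, h2 j hj, smul_zero,
        sub_zero]
    · rw [bracket, map_sub, map_sub, map_smul, map_smul, h1', h2', map_sub, map_smul]

/-- The linear map on generators that is the linear part of an algebra map. -/
noncomputable def linMap (f : Tensor V →ₐ[𝕜] Tensor W) : V.carrier →ₗ[𝕜] W.carrier :=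
  lin W ∘ₗ f.toLinearMap ∘ₗ ι 𝕜

theorem linMap_apply (f : Tensor V →ₐ[𝕜] Tensor W) (v : V.carrier) :
    linMap f v = lin W (f (ι 𝕜 v)) := rfl

theorem linMap_mem_deg {f : Tensor V →ₐ[𝕜] Tensor W} (hf : IsLieMap f) (n : ℕ) (v : V.carrier)
    (hv : v ∈ V.deg n) : linMap f v ∈ W.deg n :=
  (lin_mem_deg (U := ⊤) (hf n v hv)).2

theorem IsLieMap.ι_mem {f : Tensor V →ₐ[𝕜] Tensor W} (hf : IsLieMap f) (v : V.carrier) :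
    f (ι 𝕜 v) ∈ freeLie W := hf.mem (ι_mem_freeLie V v)

/-- The leading term of the image of a Lie monomial. -/
theorem leadingTerm_map {f : Tensor V →ₐ[𝕜] Tensor W} (hf : IsLieMap f)
    {U : Submodule 𝕜 V.carrier} {n l : ℕ} {x : Tensor V} (hx : IsLieMonomial V U n l x) :
    (∀ j < l, lenComp W j (f x) = 0) ∧ lenComp W l (f x) = tensorMap (linMap f) x := by
  induction hx with
  | gen =>
    refine ⟨fun j hj => ?_, ?_⟩
    · rw [Nat.lt_one_iff.1 hj]; exact lenComp_zero (hf.ι_mem _)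
    · rw [lenComp_one (hf.ι_mem _), tensorMap_ι]; rfl
  | @bracket m n p q a b ha hb iha ihb =>
    rw [map_bracket, map_bracket]
    refine ⟨fun j hj => ?_, ?_⟩
    · rw [bracket, map_sub, map_smul, lenComp_mul_of_lt iha.1 ihb.1 hj,
        lenComp_mul_of_lt ihb.1 iha.1 (by omega), smul_zero, sub_zero]
    · have e := lenComp_mul ihb.1 iha.1
      rw [add_comm q p] at e
      rw [bracket, map_sub, map_smul, lenComp_mul iha.1 ihb.1, e, iha.2, ihb.2]
      rfl

theorem lenComp_two_map {f : Tensor V →ₐ[𝕜] Tensor W} (hf : IsLieMap f) {x : Tensor V}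
    (hx : x ∈ freeLie V) (h0 : lin V x = 0) :
    lenComp W 2 (f x) = tensorMap (linMap f) (lenComp V 2 x) := by
  -- Precomposing with `1 - ι lin` discards the linear part, so that the identity is linear on all
  -- of `𝕃(V)` and can be tested on monomials.
  have := freeLie_induction (p := LinearMap.eqLocus
    (lenComp W 2 ∘ₗ f.toLinearMap ∘ₗ (LinearMap.id - ι 𝕜 ∘ₗ lin V))
    ((tensorMap (linMap f)).toLinearMap ∘ₗ lenComp V 2)) (fun n l x h => ?_) hx
  · simpa [h0] using this
  · simp only [LinearMap.mem_eqLocus, LinearMap.comp_apply, LinearMap.sub_apply,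
      LinearMap.id_apply, AlgHom.toLinearMap_apply, h.lenComp]
    rcases h.cases' with ⟨w, hw, rfl, rfl⟩ | ⟨hl, h0, -⟩
    · simp
    · rw [h0, map_zero, sub_zero]
      split_ifs with h2
      · subst h2; exact (leadingTerm_map hf h).2
      · rw [(leadingTerm_map hf h).1 2 (by omega), map_zero]

namespace Differential

variable (δ : Differential W)

/-- The values of the quadratic part on the generators. -/
noncomputable def quadGen : W.carrier →ₗ[𝕜] Tensor W := lenComp W 2 ∘ₗ δ.D ∘ₗ ι 𝕜

variable {δ}

theorem IsMinimal.lenComp_D_ι (hδ : δ.IsMinimal) (w : W.carrier) (j : ℕ) (hj : j < 2) :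
    lenComp W j (δ.D (ι 𝕜 w)) = 0 := by
  have hm := δ.D_mem (ι_mem_freeLie W w)
  rcases j with _ | _ | j
  · exact lenComp_zero hm
  · rw [lenComp_one hm, (isMinimal_iff δ).1 hδ, map_zero]
  · omega

theorem IsMinimal.lenComp_der (hδ : δ.IsMinimal) {n l : ℕ} {x : Tensor W}
    (hx : IsLieMonomial W ⊤ n l x) : (∀ j < l + 1, lenComp W j (δ.D x) = 0) ∧
      lenComp W (l + 1) (δ.D x) = der δ.quadGen x :=
  leadingTerm_der δ.D_isOddDer (der_isOddDer _) hδ.lenComp_D_ι (fun w => by rw [der_ι]; rfl) hx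

/-- A minimal differential raises the length, so length two is reached from length one only. -/
theorem IsMinimal.lenComp_two_D (hδ : δ.IsMinimal) {x : Tensor W} (hx : x ∈ freeLie W) :
    lenComp W 2 (δ.D x) = lenComp W 2 (δ.D (ι 𝕜 (lin W x))) := by
  refine freeLie_induction (p := LinearMap.eqLocus (lenComp W 2 ∘ₗ δ.D)
    (lenComp W 2 ∘ₗ δ.D ∘ₗ ι 𝕜 ∘ₗ lin W)) (fun n l x h => ?_) hx
  simp only [LinearMap.mem_eqLocus, LinearMap.comp_apply]
  rcases h.cases' with ⟨w, hw, rfl, rfl⟩ | ⟨hl, h0, -⟩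
  · simp
  · rw [h0, map_zero, map_zero, map_zero, (hδ.lenComp_der h).1 2 (by omega)]

/-- Only the length-two part of `x` reaches length three, and it does so through the quadratic
derivation. For `x = δ w` this shows that the quadratic part squares to zero. -/
theorem IsMinimal.lenComp_three_D (hδ : δ.IsMinimal) {x : Tensor W} (hx : x ∈ freeLie W)
    (h0 : lin W x = 0) : lenComp W 3 (δ.D x) = der δ.quadGen (lenComp W 2 x) := by
  have := freeLie_induction (p := LinearMap.eqLocus
    (lenComp W 3 ∘ₗ δ.D ∘ₗ (LinearMap.id - ι 𝕜 ∘ₗ lin W))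
    (der δ.quadGen ∘ₗ lenComp W 2)) (fun n l x h => ?_) hx
  · simpa [h0] using this
  · simp only [LinearMap.mem_eqLocus, LinearMap.comp_apply, LinearMap.sub_apply,
      LinearMap.id_apply, h.lenComp]
    rcases h.cases' with ⟨w, hw, rfl, rfl⟩ | ⟨hl, h0, -⟩
    · simp
    · rw [h0, map_zero, sub_zero]
      split_ifs with h2
      · subst h2; exact (hδ.lenComp_der h).2
      · rw [(hδ.lenComp_der h).1 3 (by omega), map_zero]

/-- A minimal differential has a quadratic part. -/
theorem IsMinimal.exists_isQuadraticPart (hδ : δ.IsMinimal) : ∃ δ₂ : Differential W,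
    δ.IsQuadraticPart δ₂ ∧ ∀ w, δ₂.D (ι 𝕜 w) = lenComp W 2 (δ.D (ι 𝕜 w)) := by
  have hm : ∀ w, δ.D (ι 𝕜 w) ∈ freeLie W := fun w => δ.D_mem (ι_mem_freeLie W w)
  have hd : ∀ w, lenComp W 2 (δ.D (ι 𝕜 w)) = δ.quadGen w := fun w => rfl
  have hg : ∀ n, ∀ w ∈ W.deg (n + 1), δ.quadGen w ∈ freeLieDeg W n := fun n w hw =>
    lenComp_mem_lieOnDeg (U := ⊤) n 2 (δ.D_ι_mem hw)
  have h0 : ∀ w, der δ.quadGen (δ.quadGen w) = 0 := fun w => by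
    rw [← hd, ← hδ.lenComp_three_D (hm w) ((isMinimal_iff δ).1 hδ w),
      δ.D_D (ι_mem_freeLie W w), map_zero]
  refine ⟨ofGen δ.quadGen hg h0, fun w => ?_, fun w => ofGen_D_ι _ hg h0 w⟩
  · rw [Submodule.coe_sub, ← D_ι, ← D_ι, ofGen_D_ι, ← hd]
    exact ⟨lenComp_mem_freeLieLength 2 (hm w), sub_lenComp_mem_iSup (hm w) 2⟩

/-- Naturality of quadratic parts. -/
theorem IsMinimal.lenComp_two_linMap {d : Differential V} {f : Tensor V →ₐ[𝕜] Tensor W}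
    (hδ : δ.IsMinimal) (hf : IsLieMap f) (hfd : ∀ x, f (d.D x) = δ.D (f x)) {v : V.carrier}
    (hv : lin V (d.D (ι 𝕜 v)) = 0) : lenComp W 2 (δ.D (ι 𝕜 (linMap f v))) =
      tensorMap (linMap f) (lenComp V 2 (d.D (ι 𝕜 v))) := by
  -- The length-two component of `f (d v) = δ (f v)` is computed in two ways; the source need not be
  -- minimal, as only `d v` must lack a linear part.
  rw [← lenComp_two_map hf (d.D_mem (ι_mem_freeLie V v)) hv, hfd, hδ.lenComp_two_D (hf.ι_mem v)]
  rfl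

end Differential

end Quadratic

/-! ### Graded subspaces, filtrations and contractions -/

section LinearAlgebra

variable (W : GradedSpace.{u, v} 𝕜)

namespace GradedSpace

theorem mem_of_proj {U : Submodule 𝕜 W.carrier} {w : W.carrier} (h : ∀ n, W.proj n w ∈ U) :
    w ∈ U := by
  classical
  -- Allowing every larger index set makes the property stable under sums.
  have hw : ∃ s : Finset ℕ, ∀ t, s ⊆ t → w = ∑ n ∈ t, W.proj n w := by
    have hw : w ∈ ⨆ n, W.deg n := by
      rw [W.isInternal.submodule_iSup_eq_top]; trivial
    clear h
    induction hw using Submodule.iSup_induction' with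
    | mem n w hw =>
      refine ⟨{n}, fun t ht => ?_⟩
      rw [Finset.sum_eq_single n]
      · rw [W.proj_same hw]
      · intro b _ hb; exact W.proj_ne hw hb.symm
      · intro hn; exact absurd (ht (Finset.mem_singleton_self n)) hn
    | zero => exact ⟨∅, by simp⟩
    | add x y _ _ hx hy =>
      obtain ⟨s, hs⟩ := hx
      obtain ⟨t, ht⟩ := hy
      refine ⟨s ∪ t, fun r hr => ?_⟩
      simp only [map_add, Finset.sum_add_distrib]
      rw [← hs r (Finset.union_subset_left hr), ← ht r (Finset.union_subset_right hr)]
  obtain ⟨s, hs⟩ := hw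
  rw [hs s subset_rfl]
  exact sum_mem fun n _ => h n

theorem ext_proj {x y : W.carrier} (h : ∀ n, W.proj n x = W.proj n y) : x = y := by
  rw [← sub_eq_zero, ← Submodule.mem_bot 𝕜]
  exact W.mem_of_proj fun n => by rw [map_sub, h, sub_self]; exact zero_mem _

/-- The graded subspaces of `W`. -/
def IsGraded (U : Submodule 𝕜 W.carrier) : Prop := ∀ n, ∀ w ∈ U, W.proj n w ∈ U

theorem isGraded_iff (U : Submodule 𝕜 W.carrier) : W.IsGraded U ↔ U = ⨆ n, U ⊓ W.deg n := by
  constructor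
  · intro h
    refine le_antisymm (fun w hw => W.mem_of_proj fun n => ?_) (iSup_le fun n => inf_le_left)
    exact Submodule.mem_iSup_of_mem n ⟨h n w hw, W.proj_mem n w⟩
  · intro h n w hw
    rw [h] at hw
    refine (iSup_le (a := U.comap (W.proj n)) fun m w hw => ?_) hw
    rw [Submodule.mem_comap]
    by_cases hm : m = n
    · subst hm; rw [W.proj_same hw.2]; exact hw.1
    · rw [W.proj_ne hw.2 hm]; exact zero_mem _

variable {W}

theorem IsGraded.iSup {ι : Sort*} {U : ι → Submodule 𝕜 W.carrier} (h : ∀ i, W.IsGraded (U i)) :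
    W.IsGraded (⨆ i, U i) := by
  intro n w hw
  refine (iSup_le (a := (⨆ i, U i).comap (W.proj n)) fun i w hw => ?_) hw
  exact Submodule.mem_iSup_of_mem i (h i n w hw)

theorem IsGraded.inf {U U' : Submodule 𝕜 W.carrier} (h : W.IsGraded U) (h' : W.IsGraded U') :
    W.IsGraded (U ⊓ U') := fun n w hw => ⟨h n w hw.1, h' n w hw.2⟩

/-- A map of degree zero commutes with the projections to the homogeneous components. -/
theorem map_proj {V : GradedSpace.{u, v} 𝕜} {f : V.carrier →ₗ[𝕜] W.carrier}
    (hf : ∀ n, ∀ v ∈ V.deg n, f v ∈ W.deg n) (n : ℕ) (v : V.carrier) :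
    f (V.proj n v) = W.proj n (f v) := by
  have : f ∘ₗ V.proj n = W.proj n ∘ₗ f := V.hom_ext fun m v hv => by
    simp only [LinearMap.comp_apply]
    by_cases hm : m = n
    · subst hm; rw [V.proj_same hv, W.proj_same (hf m v hv)]
    · rw [V.proj_ne hv hm, W.proj_ne (hf m v hv) hm, map_zero]
  exact LinearMap.congr_fun this v

/-- A map of degree `-1` shifts the projections to the homogeneous components. -/
theorem map_proj_succ {e : W.carrier →ₗ[𝕜] W.carrier}
    (he : ∀ n, ∀ w ∈ W.deg (n + 1), e w ∈ W.deg n) (n : ℕ) (w : W.carrier) :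
    e (W.proj (n + 1) w) = W.proj n (e w) := by
  have : e ∘ₗ W.proj (n + 1) = W.proj n ∘ₗ e := W.hom_ext fun m w hw => by
    simp only [LinearMap.comp_apply]
    rcases m with _ | m
    · simp [W.eq_zero_of_deg_zero hw]
    by_cases hm : m = n
    · subst hm; rw [W.proj_same hw, W.proj_same (he m w hw)]
    · rw [W.proj_ne hw (by omega), W.proj_ne (he m w hw) hm, map_zero]
  exact LinearMap.congr_fun this w

theorem IsGraded.comap {V : GradedSpace.{u, v} 𝕜} {f : V.carrier →ₗ[𝕜] W.carrier}
    (hf : ∀ n, ∀ v ∈ V.deg n, f v ∈ W.deg n) {U : Submodule 𝕜 W.carrier} (hU : W.IsGraded U) :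
    V.IsGraded (U.comap f) := fun n v hv => by
  rw [Submodule.mem_comap, map_proj hf]; exact hU n _ hv

theorem isGraded_ker {V : GradedSpace.{u, v} 𝕜} {f : V.carrier →ₗ[𝕜] W.carrier}
    (hf : ∀ n, ∀ v ∈ V.deg n, f v ∈ W.deg n) : V.IsGraded (LinearMap.ker f) := fun n v hv => by
  rw [LinearMap.mem_ker] at *
  rw [map_proj hf, hv, map_zero]

variable (W)

/-- The component of degree `r` of an endomorphism. -/
noncomputable def degPart (r : ℕ) (t : W.carrier →ₗ[𝕜] W.carrier) : W.carrier →ₗ[𝕜] W.carrier :=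
  W.lift fun n => W.proj (n + r) ∘ₗ t ∘ₗ (W.deg n).subtype

theorem degPart_apply (r : ℕ) (t : W.carrier →ₗ[𝕜] W.carrier) {n : ℕ} {w : W.carrier}
    (hw : w ∈ W.deg n) : W.degPart r t w = W.proj (n + r) (t w) := by
  rw [degPart, W.lift_apply _ hw]; rfl

theorem degPart_mem (r : ℕ) (t : W.carrier →ₗ[𝕜] W.carrier) {n : ℕ} {w : W.carrier}
    (hw : w ∈ W.deg n) : W.degPart r t w ∈ W.deg (n + r) := by
  rw [W.degPart_apply r t hw]; exact W.proj_mem _ _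

/-- A subspace has a projection that is compatible with a given filtration. -/
theorem exists_projection {F : ℕ → Submodule 𝕜 W.carrier} (hF : Monotone F) (h0 : F 0 = ⊥)
    {k : ℕ} (hk : F k = ⊤) (Z : Submodule 𝕜 W.carrier) : ∃ q : W.carrier →ₗ[𝕜] W.carrier,
      (∀ w, q w ∈ Z) ∧ (∀ z ∈ Z, q z = z) ∧ ∀ i, ∀ w ∈ F i, q w ∈ F i := by
  -- A complement of `Z` is grown along the filtration: at each stage `C` is enlarged to a
  -- complement of `Z ⊓ F (m + 1)` and cut down to `F (m + 1)`. Each `F j` is then the sum of its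
  -- traces on `Z` and `C`, as compatibility of the projection requires.
  have key : ∀ m, ∃ C ≤ F m, Disjoint Z C ∧ ∀ j ≤ m, F j ≤ (Z ⊓ F j) ⊔ (C ⊓ F j) := by
    intro m
    induction m with
    | zero =>
      refine ⟨⊥, bot_le, disjoint_bot_right, fun j hj => ?_⟩
      rw [Nat.le_zero.1 hj, h0]; exact bot_le
    | succ m ih =>
      obtain ⟨C, hC, hd, h⟩ := ih
      obtain ⟨C', hCC', hc⟩ := (hd.mono_left (inf_le_left (b := F (m + 1)))).symm.exists_isCompl
      replace hc := hc.symm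
      have hle : C ≤ C' ⊓ F (m + 1) := le_inf hCC' (hC.trans (hF m.le_succ))
      refine ⟨C' ⊓ F (m + 1), inf_le_right, ?_, fun j hj => ?_⟩
      · rw [disjoint_iff]
        have := hc.disjoint.eq_bot
        rw [← this, inf_assoc, inf_comm (F (m + 1))]
      · rcases hj.lt_or_eq with hj | rfl
        · exact (h j (Nat.lt_succ_iff.1 hj)).trans (sup_le_sup_left (inf_le_inf_right _ hle) _)
        · intro x hx
          have hx' : x ∈ (Z ⊓ F (m + 1)) ⊔ C' := by rw [hc.sup_eq_top]; trivial
          obtain ⟨z, hz, c, hc, rfl⟩ := Submodule.mem_sup.1 hx'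
          have hcF : c ∈ F (m + 1) := by
            have := sub_mem hx hz.2
            rwa [add_sub_cancel_left] at this
          exact Submodule.add_mem_sup hz ⟨⟨hc, hcF⟩, hcF⟩
  obtain ⟨C, -, hd, h⟩ := key k
  have hc : IsCompl Z C := ⟨hd, by
    rw [codisjoint_iff, eq_top_iff, ← hk]
    exact (h k le_rfl).trans (sup_le_sup inf_le_left inf_le_left)⟩
  refine ⟨Z.projection C hc, fun w => Submodule.projection_apply_mem hc w,
    fun z hz => Submodule.projection_apply_left hc ⟨z, hz⟩, fun i w hw => ?_⟩
  rcases le_total i k with hi | hi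
  · obtain ⟨z, hz, c, hc', rfl⟩ := Submodule.mem_sup.1 (h i hi hw)
    rw [map_add, Submodule.projection_apply_left hc ⟨z, hz.1⟩,
      Submodule.projection_apply_right hc ⟨c, hc'.1⟩, add_zero]
    exact hz.2
  · have : F i = ⊤ := eq_top_iff.2 (hk ▸ hF hi)
    rw [this]; trivial

/-- A graded subspace has a graded projection that is compatible with a given filtration. -/
theorem exists_graded_projection {F : ℕ → Submodule 𝕜 W.carrier} (hF : Monotone F)
    (h0 : F 0 = ⊥) {k : ℕ} (hk : F k = ⊤) (hFg : ∀ i, W.IsGraded (F i))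
    {Z : Submodule 𝕜 W.carrier} (hZ : W.IsGraded Z) : ∃ q : W.carrier →ₗ[𝕜] W.carrier,
      (∀ n, ∀ w ∈ W.deg n, q w ∈ W.deg n) ∧ (∀ w, q w ∈ Z) ∧ (∀ z ∈ Z, q z = z) ∧
        ∀ i, ∀ w ∈ F i, q w ∈ F i := by
  obtain ⟨q, hq, hq', hqF⟩ := W.exists_projection hF h0 hk Z
  have hdeg : ∀ n, ∀ w ∈ W.deg n, W.degPart 0 q w ∈ W.deg n := fun n w hw =>
    W.degPart_mem 0 q hw
  have hc : ∀ n w, W.proj n (W.degPart 0 q w) = W.proj n (q (W.proj n w)) := fun n w => by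
    rw [← map_proj hdeg, W.degPart_apply 0 q (W.proj_mem n w), add_zero]
  -- The degree-zero part of an ungraded projection still works, since its component in degree `n`
  -- is `proj n ∘ q ∘ proj n` and graded subspaces are stable under `proj n`.
  refine ⟨W.degPart 0 q, hdeg, fun w => W.mem_of_proj fun n => ?_, fun z hz =>
    W.ext_proj fun n => ?_, fun i w hw => W.mem_of_proj fun n => ?_⟩
  · rw [hc]; exact hZ n _ (hq _)
  · rw [hc, hq' _ (hZ n z hz), W.proj_same (W.proj_mem n z)]
  · rw [hc]; exact hFg i n _ (hqF i _ (hFg i n w hw))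

/-- A filtration of finite length splits. -/
theorem exists_splitting {F : ℕ → Submodule 𝕜 W.carrier} (hF : Monotone F)
    (h0 : F 0 = ⊥) {k : ℕ} (hk : F k = ⊤) (hFg : ∀ i, W.IsGraded (F i)) :
    ∃ P : Fin k → Submodule 𝕜 W.carrier, DirectSum.IsInternal P ∧
      (∀ i, P i = ⨆ n, P i ⊓ W.deg n) ∧ (∀ i : Fin k, P i ≤ F (i + 1)) ∧
        ∀ m ≤ k, below P (m + 1) = F m := by
  choose q hqd hq hq' hqF using fun i => W.exists_graded_projection hF h0 hk hFg (hFg i)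
  -- `P i` is a complement of `F i` in `F (i + 1)`.
  let P : Fin k → Submodule 𝕜 W.carrier := fun i => LinearMap.ker (q i) ⊓ F (i + 1)
  have hbelow : ∀ m ≤ k, below P (m + 1) = F m := by
    intro m
    induction m with
    | zero => intro _; simp [below, h0]
    | succ m ih =>
      intro hm
      have e : below P (m + 1 + 1) = below P (m + 1) ⊔ P ⟨m, hm⟩ := by
        refine le_antisymm (iSup₂_le fun i hi => ?_) (sup_le (iSup₂_le fun i hi => ?_) ?_)
        · rcases lt_or_eq_of_le (show (i : ℕ) ≤ m by omega) with h | h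
          · exact le_sup_of_le_left (le_iSup₂_of_le (f := fun (i : Fin k)
              (_ : (i : ℕ) + 1 < m + 1) => P i) i (by omega) le_rfl)
          · have : i = ⟨m, hm⟩ := Fin.ext h
            rw [this]; exact le_sup_right
        · exact le_iSup₂_of_le (f := fun (i : Fin k) (_ : (i : ℕ) + 1 < m + 1 + 1) => P i) i
            (by omega) le_rfl
        · exact le_iSup₂_of_le (f := fun (i : Fin k) (_ : (i : ℕ) + 1 < m + 1 + 1) => P i)
            ⟨m, hm⟩ (by simp) le_rfl
      rw [e, ih (by omega)]
      refine le_antisymm (sup_le (hF m.le_succ) inf_le_right) fun x hx => ?_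
      have hxq := hF m.le_succ (hq m x)
      rw [← add_sub_cancel (q m x) x]
      refine Submodule.add_mem_sup (hq m x) ⟨?_, sub_mem hx hxq⟩
      exact LinearMap.mem_ker.2 (by rw [map_sub, hq' m _ (hq m x), sub_self])
  refine ⟨P, ?_, fun i => (W.isGraded_iff _).1 ((isGraded_ker (hqd i)).inf (hFg _)),
    fun i => inf_le_right, hbelow⟩
  refine DirectSum.isInternal_submodule_of_iSupIndep_of_iSup_eq_top ?_ ?_
  · rw [iSupIndep_iff_finsetSum_eq_zero_imp_eq_zero]
    intro s
    induction s using Finset.induction_on_max with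
    | empty => simp
    | insert a s has ih =>
      intro v hv hs
      have ha : a ∉ s := fun h => lt_irrefl _ (has a h)
      rw [Finset.sum_insert ha] at hs
      -- The relation puts the term of largest index into `F a`, where `q a` is the identity, while
      -- `q a` kills that term.
      have hva : v a = 0 := by
        have h1 : v a ∈ F a := by
          rw [eq_neg_of_add_eq_zero_left hs]
          refine neg_mem (sum_mem fun i hi => ?_)
          have hia : (i : ℕ) < a := has i hi
          exact hF (show (i : ℕ) + 1 ≤ a by omega) (hv i (Finset.mem_insert_of_mem hi)).2
        rw [← hq' a _ h1]
        exact (hv a (Finset.mem_insert_self a s)).1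
      rw [hva, zero_add] at hs
      intro i hi
      rcases Finset.mem_insert.1 hi with rfl | hi
      · exact hva
      · exact ih v (fun i hi => hv i (Finset.mem_insert_of_mem hi)) hs i hi
  · rw [eq_top_iff, ← hk, ← hbelow k le_rfl]
    exact iSup₂_le fun i _ => le_iSup P i

/-- A complex that is filtered by graded subspaces contracts to its homology, by a projection that
preserves the filtration. -/
theorem exists_contraction {F : ℕ → Submodule 𝕜 W.carrier} (hF : Monotone F)
    (h0 : F 0 = ⊥) {k : ℕ} (hk : F k = ⊤) (hFg : ∀ i, W.IsGraded (F i))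
    {e : W.carrier →ₗ[𝕜] W.carrier} (he : ∀ n, ∀ w ∈ W.deg (n + 1), e w ∈ W.deg n)
    (hee : ∀ w, e (e w) = 0) : ∃ p h : W.carrier →ₗ[𝕜] W.carrier,
      (∀ n, ∀ w ∈ W.deg n, p w ∈ W.deg n) ∧ (∀ n, ∀ w ∈ W.deg n, h w ∈ W.deg (n + 1)) ∧
      (∀ w, p w + h (e w) + e (h w) = w) ∧ (∀ w, h (h w) = 0) ∧ (∀ w, h (p w) = 0) ∧
      (∀ w, p (h w) = 0) ∧ (∀ w, p (e w) = 0) ∧ (∀ w, e (p w) = 0) ∧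
      ∀ i, ∀ w ∈ F i, p w ∈ F i := by
  have hker : W.IsGraded (LinearMap.ker e) := fun n w hw => by
    rw [LinearMap.mem_ker] at *
    rcases n with _ | n
    · rw [W.eq_zero_of_deg_zero (W.proj_mem 0 w), map_zero]
    · rw [map_proj_succ he, hw, map_zero]
  have hrange : W.IsGraded (LinearMap.range e) := by
    rintro n _ ⟨w, rfl⟩
    exact ⟨W.proj (n + 1) w, map_proj_succ he n w⟩
  obtain ⟨qZ, hZd, hZ, hZ', hZF⟩ := W.exists_graded_projection hF h0 hk hFg hker
  obtain ⟨qB, hBd, hB, hB', hBF⟩ := W.exists_graded_projection hF h0 hk hFg hrange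
  simp only [LinearMap.mem_ker, LinearMap.mem_range, forall_exists_index] at hZ hZ' hB hB'
  have hB'e : ∀ w, qB (e w) = e w := fun w => hB' _ w rfl
  -- A linear section of `e` over its range, extended to `W` and replaced by its part of degree one.
  obtain ⟨r, hr⟩ := e.rangeRestrict.exists_rightInverse_of_surjective e.range_rangeRestrict
  obtain ⟨t, ht⟩ := r.exists_extend
  have hte : ∀ w, e (t (e w)) = e w := fun w => by
    have h1 : t (e w) = r (e.rangeRestrict w) := LinearMap.congr_fun ht (e.rangeRestrict w)
    rw [h1]
    exact congrArg Subtype.val (LinearMap.congr_fun hr (e.rangeRestrict w))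
  have hs : e ∘ₗ W.degPart 1 t ∘ₗ e = e := W.hom_ext fun n w hw => by
    simp only [LinearMap.comp_apply]
    rcases n with _ | n
    · simp [W.eq_zero_of_deg_zero hw]
    · rw [W.degPart_apply 1 t (he n w hw), map_proj_succ he, hte, W.proj_same (he n w hw)]
  set s := W.degPart 1 t with hs_def
  have hse : ∀ w, e (s (e w)) = e w := fun w => LinearMap.congr_fun hs w
  have hsB : ∀ w, e (s (qB w)) = qB w := fun w => by
    obtain ⟨y, hy⟩ := hB w
    rw [← hy, hse]
  have heB : ∀ w, e (qB w) = 0 := fun w => by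
    obtain ⟨y, hy⟩ := hB w
    rw [← hy, hee]
  have hZe : ∀ w, qZ (e w) = e w := fun w => hZ' _ (hee w)
  have hZB : ∀ w, qZ (qB w) = qB w := fun w => hZ' _ (heB w)
  have hZZ : ∀ w, qZ (qZ w) = qZ w := fun w => hZ' _ (hZ w)
  have hBB : ∀ w, qB (qB w) = qB w := fun w => by
    obtain ⟨y, hy⟩ := hB w
    rw [← hy, hB'e]
  -- `p` takes the cycle part modulo its boundary part; `h` lifts the boundary part along `e`. The
  -- factor `1 - qZ` removes cycles from the lift, which gives `hh = 0` and `ph = 0`.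
  refine ⟨qZ - qB ∘ₗ qZ, (LinearMap.id - qZ) ∘ₗ s ∘ₗ qB ∘ₗ qZ, ?_, ?_, ?_, ?_, ?_, ?_, ?_, ?_, ?_⟩
  · exact fun n w hw => sub_mem (hZd n w hw) (hBd n _ (hZd n w hw))
  · intro n w hw
    have h1 := W.degPart_mem 1 t (hBd n _ (hZd n w hw))
    exact sub_mem h1 (hZd _ _ h1)
  · intro w
    have h1 : s (e w) - qZ (s (e w)) = w - qZ w := by
      have : qZ (s (e w) - w) = s (e w) - w := hZ' _ (by rw [map_sub, hse, sub_self])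
      rw [map_sub] at this
      rw [sub_eq_sub_iff_sub_eq_sub, ← this]
    simp only [LinearMap.sub_apply, LinearMap.comp_apply, LinearMap.id_apply, hZe, hB'e, h1,
      map_sub, hsB, hZ]
    abel
  all_goals
    intro w
    simp only [LinearMap.sub_apply, LinearMap.comp_apply, LinearMap.id_apply, hZe, hB'e,
      map_sub, hZ, hZZ, hBB, hZB, heB, sub_self]
  intro x hx
  exact sub_mem (hZF w x hx) (hBF w _ (hZF w x hx))

/-- The image of a projection of degree zero, as a graded space. -/
def ofRange {p : W.carrier →ₗ[𝕜] W.carrier} (hp : ∀ n, ∀ w ∈ W.deg n, p w ∈ W.deg n) :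
    GradedSpace.{u, v} 𝕜 where
  carrier := LinearMap.range p
  deg n := (W.deg n).comap (LinearMap.range p).subtype
  isInternal := by
    refine DirectSum.isInternal_submodule_of_iSupIndep_of_iSup_eq_top ?_ ?_
    · rw [iSupIndep_iff_finsetSum_eq_zero_imp_eq_zero]
      intro s v hv hs i hi
      have := (iSupIndep_iff_finsetSum_eq_zero_imp_eq_zero _).1 W.isInternal.submodule_iSupIndep s
        (fun i => (v i : W.carrier)) hv (by
          rw [← Submodule.coe_sum, hs, Submodule.coe_zero]) i hi
      exact Subtype.ext this
    · rw [eq_top_iff]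
      rintro ⟨_, w, rfl⟩ -
      exact W.le_of_deg_le (p := (⨆ n, (W.deg n).comap (LinearMap.range p).subtype).comap
        p.rangeRestrict) (fun n w hw => Submodule.mem_iSup_of_mem n (hp n w hw)) w
  deg_zero := by
    rw [eq_bot_iff]
    intro w hw
    exact Subtype.ext (W.eq_zero_of_deg_zero hw)

end GradedSpace

variable {W}

/-- The filtration associated with a decomposition. -/
theorem below_mono {k : ℕ} (P : Fin k → Submodule 𝕜 W.carrier) : Monotone (below P) :=
  fun _ _ h => iSup₂_le fun i hi =>
    le_iSup₂_of_le (f := fun (i : Fin k) (_ : (i : ℕ) + 1 < _) => P i) i (hi.trans_le h) le_rfl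

/-- A filtration yields a decomposition. -/
theorem exists_decomposition (δ : Differential W) {F : ℕ → Submodule 𝕜 W.carrier}
    (hF : Monotone F) (h0 : F 0 = ⊥) {k : ℕ} (hk : F k = ⊤) (hFg : ∀ i, W.IsGraded (F i))
    (h : ∀ i, ∀ w ∈ F (i + 1), δ.D (ι 𝕜 w) ∈ lieOn W (F i)) :
    ∃ E : Decomposition δ k, ∀ m ≤ k, below E.piece (m + 1) = F m := by
  obtain ⟨P, hP, hPg, hPF, hb⟩ := W.exists_splitting hF h0 hk hFg
  refine ⟨⟨P, hP, hPg, fun i w hw => ?_⟩, hb⟩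
  rw [hb i i.2.le, ← δ.D_ι]
  exact h i w (hPF i hw)

theorem Decomposition.isGraded_below {δ : Differential W} {k : ℕ} (E : Decomposition δ k) (m : ℕ) :
    W.IsGraded (below E.piece m) :=
  .iSup fun i => .iSup fun _ => (W.isGraded_iff _).2 (E.graded i)

theorem Decomposition.below_eq_top {δ : Differential W} {k : ℕ} (E : Decomposition δ k) :
    below E.piece (k + 1) = ⊤ := by
  rw [eq_top_iff, ← E.isInternal.submodule_iSup_eq_top]
  exact iSup_le fun i => le_iSup₂_of_le (f := fun (i : Fin k) (_ : (i : ℕ) + 1 < k + 1) =>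
    E.piece i) i (by omega) le_rfl

theorem Decomposition.D_mem_below {δ : Differential W} {k : ℕ} (E : Decomposition δ k) {m : ℕ}
    {w : W.carrier} (hw : w ∈ below E.piece (m + 1)) :
    δ.D (ι 𝕜 w) ∈ lieOn W (below E.piece m) := by
  refine (iSup₂_le (a := (lieOn W (below E.piece m)).comap (δ.D ∘ₗ ι 𝕜)) fun i hi w hw => ?_) hw
  rw [Submodule.mem_comap, LinearMap.comp_apply, δ.D_ι]
  exact lieOn_mono (below_mono _ (by omega)) (E.d_mem i w hw)

end LinearAlgebra

/-! ### Contraction of a free dgl to its minimal part -/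

/-- A contraction of the generators of `(𝕃(W), δ)`: the projection `p` and the homotopy `h` satisfy
`1 - p = he + eh` and the side conditions, and `δ` is equal to `e` on the image of `h`. -/
structure StrictContraction {W : GradedSpace.{u, v} 𝕜} (δ : Differential W) where
  p : W.carrier →ₗ[𝕜] W.carrier
  h : W.carrier →ₗ[𝕜] W.carrier
  e : W.carrier →ₗ[𝕜] W.carrier
  p_deg : ∀ n, ∀ w ∈ W.deg n, p w ∈ W.deg n
  h_deg : ∀ n, ∀ w ∈ W.deg n, h w ∈ W.deg (n + 1)
  dec : ∀ w, p w + h (e w) + e (h w) = w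
  h_h : ∀ w, h (h w) = 0
  h_p : ∀ w, h (p w) = 0
  p_h : ∀ w, p (h w) = 0
  p_e : ∀ w, p (e w) = 0
  D_h : ∀ w, δ.D (ι 𝕜 (h w)) = ι 𝕜 (e (h w))

/-! ### Generalized eigenspaces and polynomials in an endomorphism -/

/-- Polynomials in an endomorphism preserve invariant subspaces. -/
theorem aeval_mem {E : Type*} [AddCommGroup E] [Module 𝕜 E] {N : Module.End 𝕜 E}
    {M : Submodule 𝕜 E} (hM : ∀ x ∈ M, N x ∈ M) (r : 𝕜[X]) {x : E} (hx : x ∈ M) :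
    aeval N r x ∈ M := by
  induction r using Polynomial.induction_on' with
  | add p q hp hq => rw [map_add, LinearMap.add_apply]; exact add_mem hp hq
  | monomial n a =>
    rw [aeval_monomial, Module.End.mul_apply, Module.algebraMap_end_apply]
    refine M.smul_mem a ?_
    induction n with
    | zero => simpa using hx
    | succ n ih => rw [pow_succ', Module.End.mul_apply]; exact hM _ ih

theorem aeval_comm_apply {E : Type*} [AddCommGroup E] [Module 𝕜 E] (N : Module.End 𝕜 E)
    (r : 𝕜[X]) (x : E) : N (aeval N r x) = aeval N r (N x) := by
  have : N * aeval N r = aeval N r * N := by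
    conv_lhs => enter [1]; rw [← aeval_X (R := 𝕜) N]
    conv_rhs => enter [2]; rw [← aeval_X (R := 𝕜) N]
    rw [← map_mul, ← map_mul, mul_comm]
  exact LinearMap.congr_fun this x

/-- An endomorphism is invertible, by a polynomial, on the sum of the generalized eigenspaces of
nonzero eigenvalues. -/
theorem exists_aeval_inverse {E : Type*} [AddCommGroup E] [Module 𝕜 E] (N : Module.End 𝕜 E)
    {κ : Type*} {μ : κ → 𝕜} (hμ : ∀ i, μ i ≠ 0) {z : E}
    (hz : z ∈ ⨆ i, N.maxGenEigenspace (μ i)) : ∃ r : 𝕜[X], N (aeval N r z) = z := by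
  -- A product of powers of `X - μ i` annihilates `z`, and its constant term is nonzero. Writing it
  -- as `X` times `divX q` plus that constant solves for `z`.
  have hq : ∃ q : 𝕜[X], q.coeff 0 ≠ 0 ∧ aeval N q z = 0 := by
    induction hz using Submodule.iSup_induction' with
    | mem i x hx =>
      obtain ⟨m, hm⟩ := Module.End.mem_maxGenEigenspace N (μ i) x |>.1 hx
      refine ⟨(X - C (μ i)) ^ m, ?_, ?_⟩
      · rw [coeff_zero_eq_eval_zero]
        simp [hμ i]
      · rw [← hm]
        simp [Algebra.algebraMap_eq_smul_one]
    | zero => exact ⟨1, by simp, by simp⟩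
    | add x y _ _ hx hy =>
      obtain ⟨q, hq, hq'⟩ := hx
      obtain ⟨r, hr, hr'⟩ := hy
      refine ⟨q * r, by simp [mul_coeff_zero, hq, hr], ?_⟩
      rw [map_add]
      nth_rw 1 [mul_comm]
      rw [map_mul, map_mul, Module.End.mul_apply, Module.End.mul_apply, hq', hr', map_zero,
        map_zero, add_zero]
  obtain ⟨q, hq, hq'⟩ := hq
  refine ⟨C (-(q.coeff 0)⁻¹) * divX q, ?_⟩
  have h1 : N (aeval N (divX q) z) + q.coeff 0 • z = 0 := by
    rw [← hq']
    conv_rhs => rw [← divX_mul_X_add q]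
    simp [aeval_comm_apply]
  rw [map_mul, aeval_C, Module.End.mul_apply, Module.algebraMap_end_apply, map_smul,
    eq_neg_of_add_eq_zero_left h1, smul_neg, neg_smul, neg_neg, smul_smul, inv_mul_cancel₀ hq,
    one_smul]

/-- Generalized eigenspaces of a derivation are multiplicative. -/
theorem mul_mem_maxGenEigenspace {A : Type*} [Ring A] [Algebra 𝕜 A] {N : Module.End 𝕜 A}
    (hN : ∀ x y, N (x * y) = x * N y + N x * y) {a b : 𝕜} {x y : A}
    (hx : x ∈ N.maxGenEigenspace a) (hy : y ∈ N.maxGenEigenspace b) :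
    x * y ∈ N.maxGenEigenspace (a + b) := by
  rw [Module.End.mem_maxGenEigenspace] at *
  obtain ⟨m, hm⟩ := hx
  obtain ⟨n, hn⟩ := hy
  refine ⟨m + n, ?_⟩
  generalize hs : m + n = s
  induction s generalizing m n x y with
  | zero =>
    rw [show m = 0 by omega] at hm
    have : x = 0 := by simpa using hm
    rw [this, zero_mul, map_zero]
  | succ s ih =>
    rcases m with _ | m
    · have : x = 0 := by simpa using hm
      rw [this, zero_mul, map_zero]
    rcases n with _ | n
    · have : y = 0 := by simpa using hn
      rw [this, mul_zero, map_zero]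
    -- The Leibniz rule splits `N - (a + b)` into `N - a` on the first factor and `N - b` on the
    -- second; either way the sum of the two exponents drops.
    have e : (N - (a + b) • 1) (x * y) = (N - a • 1) x * y + x * (N - b • 1) y := by
      simp only [LinearMap.sub_apply, LinearMap.smul_apply, Module.End.one_apply, hN, sub_mul,
        mul_sub, smul_mul_assoc, mul_smul_comm, add_smul, LinearMap.add_apply]
      abel
    rw [pow_succ, Module.End.mul_apply, e, map_add]
    rw [ih m (by rwa [pow_succ, Module.End.mul_apply] at hm) (n + 1) hn (by omega),
      ih (m + 1) hm n (by rwa [pow_succ, Module.End.mul_apply] at hn) (by omega), add_zero]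

theorem mul_mem_of_mem_iSup {A : Type*} [Ring A] [Algebra 𝕜 A] {κ κ' : Type*}
    {G : κ → Submodule 𝕜 A} {G' : κ' → Submodule 𝕜 A} {Q : Submodule 𝕜 A}
    (h : ∀ i j, ∀ x ∈ G i, ∀ y ∈ G' j, x * y ∈ Q) {x y : A} (hx : x ∈ ⨆ i, G i)
    (hy : y ∈ ⨆ j, G' j) : x * y ∈ Q := by
  induction hx using Submodule.iSup_induction' with
  | mem i x hx =>
    induction hy using Submodule.iSup_induction' with
    | mem j y hy => exact h i j x hx y hy
    | zero => rw [mul_zero]; exact zero_mem _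
    | add y y' _ _ hy hy' => rw [mul_add]; exact add_mem hy hy'
  | zero => rw [zero_mul]; exact zero_mem _
  | add x x' _ _ hx hx' => rw [add_mul]; exact add_mem hx hx'

/-! ### The derivation `δH + Hδ` and the contracted dgl -/

namespace StrictContraction

variable {W : GradedSpace.{u, v} 𝕜} {δ : Differential W} (c : StrictContraction δ)

/-- The extension of the homotopy to an odd derivation. -/
noncomputable def H : Tensor W →ₗ[𝕜] Tensor W := der (ι 𝕜 ∘ₗ c.h)

/-- The derivation `δH + Hδ`. -/
noncomputable def N : Module.End 𝕜 (Tensor W) := δ.D ∘ₗ c.H + c.H ∘ₗ δ.D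

/-- The graded space of the generators that survive. -/
noncomputable def S : GradedSpace.{u, v} 𝕜 := W.ofRange c.p_deg

/-- The projection to the surviving generators. -/
noncomputable def toS : W.carrier →ₗ[𝕜] c.S.carrier := c.p.rangeRestrict

/-- The inclusion of the surviving generators. -/
noncomputable def ofS : c.S.carrier →ₗ[𝕜] W.carrier := (LinearMap.range c.p).subtype

/-- The projection of tensor algebras. -/
noncomputable def P : Tensor W →ₐ[𝕜] Tensor c.S := tensorMap c.toS

theorem H_ι (w : W.carrier) : c.H (ι 𝕜 w) = ι 𝕜 (c.h w) := by rw [H, der_ι]; rfl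

theorem H_isOddDer : IsOddDer c.H := der_isOddDer _

theorem H_sgn (x : Tensor W) : c.H (sgn W x) = -sgn W (c.H x) :=
  c.H_isOddDer.sgn_comm (fun n w hw => by
    rw [sgn_ι hw, map_smul, H_ι, sgn_ι (c.h_deg n w hw), pow_succ]
    simp) x

theorem H_mem_deg {n : ℕ} {x : Tensor W} (hx : x ∈ freeLieDeg W n) :
    c.H x ∈ freeLieDeg W (n + 1) :=
  c.H_isOddDer.mem_freeLieDeg_succ (fun n w hw => by
    rw [H_ι]; exact ι_mem_freeLieDeg (c.h_deg n w hw)) hx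

theorem H_mem {x : Tensor W} (hx : x ∈ freeLie W) : c.H x ∈ freeLie W :=
  freeLie_induction (p := (freeLie W).comap c.H) (fun _ _ _ h =>
    freeLieDeg_le_freeLie _ (c.H_mem_deg h.mem_freeLieDeg)) hx

theorem N_apply (x : Tensor W) : c.N x = δ.D (c.H x) + c.H (δ.D x) := rfl

theorem N_mul (x y : Tensor W) : c.N (x * y) = x * c.N y + c.N x * y :=
  δ.D_isOddDer.comm_mul c.H_isOddDer δ.D_sgn c.H_sgn x y

theorem N_mem_deg {n : ℕ} {x : Tensor W} (hx : x ∈ freeLieDeg W n) : c.N x ∈ freeLieDeg W n := by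
  rcases n with _ | n
  · rw [freeLieDeg_zero, Submodule.mem_bot] at hx
    rw [hx, map_zero]; exact zero_mem _
  · exact add_mem (δ.D_mem_deg (c.H_mem_deg hx)) (c.H_mem_deg (δ.D_mem_deg hx))

theorem toS_deg (n : ℕ) (w : W.carrier) (hw : w ∈ W.deg n) : c.toS w ∈ c.S.deg n :=
  c.p_deg n w hw

theorem ofS_deg (n : ℕ) (s : c.S.carrier) (hs : s ∈ c.S.deg n) : c.ofS s ∈ W.deg n := hs

theorem ofS_toS (w : W.carrier) : c.ofS (c.toS w) = c.p w := rfl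

theorem toS_eq_zero {w : W.carrier} (hw : c.p w = 0) : c.toS w = 0 := Subtype.ext hw

theorem p_p (w : W.carrier) : c.p (c.p w) = c.p w := by
  have := congrArg c.p (c.dec w)
  simpa [c.p_h, c.p_e] using this

theorem toS_ofS (s : c.S.carrier) : c.toS (c.ofS s) = s := by
  obtain ⟨_, w, rfl⟩ := s
  exact Subtype.ext (c.p_p w)

theorem P_ι (w : W.carrier) : c.P (ι 𝕜 w) = ι 𝕜 (c.toS w) := tensorMap_ι _ _

theorem P_isLieMap : IsLieMap c.P := tensorMap_isLieMap c.toS_deg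

theorem P_tensorMap_ofS (x : Tensor c.S) : c.P (tensorMap c.ofS x) = x := by
  have : c.P.comp (tensorMap c.ofS) = AlgHom.id 𝕜 _ := algHom_ext_deg fun n s hs => by
    simp [P_ι, toS_ofS]
  exact DFunLike.congr_fun this x

theorem P_H (x : Tensor W) : c.P (c.H x) = 0 := by
  refine tensor_induction (p := LinearMap.ker (c.P.toLinearMap ∘ₗ c.H)) ?_ ?_ ?_ x
  · simp [c.H_isOddDer.map_one]
  · intro n w _
    simp [H_ι, P_ι, c.toS_eq_zero (c.p_h w)]
  · intro x y hx hy
    simp only [LinearMap.mem_ker, LinearMap.comp_apply, AlgHom.toLinearMap_apply] at *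
    rw [c.H_isOddDer, map_add, map_mul, map_mul, hx, hy, mul_zero, zero_mul, add_zero]

theorem D_e_h (w : W.carrier) : δ.D (ι 𝕜 (c.e (c.h w))) = 0 := by
  rw [← c.D_h, δ.D_D (ι_mem_freeLie W _)]

/-- By `D_h`, the contractible generators `h u` and `e h u` span a subcomplex, which `P` kills;
hence `δ` descends along `P`. -/
theorem P_D_ι (w : W.carrier) : c.P (δ.D (ι 𝕜 w)) = c.P (δ.D (ι 𝕜 (c.p w))) := by
  conv_lhs => rw [← c.dec w]
  rw [map_add, map_add, map_add, map_add, map_add, map_add, c.D_e_h, c.D_h, P_ι,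
    c.toS_eq_zero (c.p_e _), map_zero, map_zero, add_zero, add_zero]

/-- The values of the induced differential on the generators. -/
noncomputable def gS : c.S.carrier →ₗ[𝕜] Tensor c.S :=
  c.P.toLinearMap ∘ₗ δ.D ∘ₗ ι 𝕜 ∘ₗ c.ofS

theorem gS_deg (n : ℕ) (s : c.S.carrier) (hs : s ∈ c.S.deg (n + 1)) :
    c.gS s ∈ freeLieDeg c.S n :=
  c.P_isLieMap.mem_deg (δ.D_ι_mem (c.ofS_deg _ s hs))

theorem P_D_der (x : Tensor W) : c.P (δ.D x) = der c.gS (c.P x) :=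
  δ.D_isOddDer.comm c.P_isLieMap.sgn (der_isOddDer _) (fun n w _ => by
    rw [P_D_ι, P_ι, der_ι]; rfl) x

theorem der_gS (s : c.S.carrier) : der c.gS (c.gS s) = 0 := by
  have h : c.gS s = c.P (δ.D (ι 𝕜 (c.ofS s))) := rfl
  rw [h, ← P_D_der, δ.D_D (ι_mem_freeLie W _), map_zero]

/-- The induced differential. -/
noncomputable def dS : Differential c.S := .ofGen c.gS c.gS_deg c.der_gS

theorem dS_ι (s : c.S.carrier) : c.dS.D (ι 𝕜 s) = c.P (δ.D (ι 𝕜 (c.ofS s))) :=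
  Differential.ofGen_D_ι _ c.gS_deg c.der_gS s

theorem P_D (x : Tensor W) : c.P (δ.D x) = c.dS.D (c.P x) :=
  δ.D_isOddDer.comm c.P_isLieMap.sgn c.dS.D_isOddDer (fun n w _ => by
    rw [P_D_ι, P_ι, dS_ι]; rfl) x

theorem P_N (x : Tensor W) : c.P (c.N x) = 0 := by
  rw [N_apply, map_add, P_D, P_H, P_H, map_zero, add_zero]

/-! ### Eigenvalues of `N` -/

/-- The sum of the generalized eigenspaces of `N` for nonnegative integers. -/
noncomputable def A : Submodule 𝕜 (Tensor W) := ⨆ j : ℕ, c.N.maxGenEigenspace (j : 𝕜)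

/-- The sum of the generalized eigenspaces of `N` for positive integers. -/
noncomputable def I : Submodule 𝕜 (Tensor W) := ⨆ j : ℕ, c.N.maxGenEigenspace ((j + 1 : ℕ) : 𝕜)

theorem maxGenEigenspace_le_A (j : ℕ) : c.N.maxGenEigenspace (j : 𝕜) ≤ c.A :=
  le_iSup (fun j : ℕ => c.N.maxGenEigenspace (j : 𝕜)) j

theorem maxGenEigenspace_le_I (j : ℕ) : c.N.maxGenEigenspace ((j + 1 : ℕ) : 𝕜) ≤ c.I :=
  le_iSup (fun j : ℕ => c.N.maxGenEigenspace ((j + 1 : ℕ) : 𝕜)) j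

theorem I_le_A : c.I ≤ c.A := iSup_le fun j => c.maxGenEigenspace_le_A (j + 1)

theorem A_mul_A {x y : Tensor W} (hx : x ∈ c.A) (hy : y ∈ c.A) : x * y ∈ c.A :=
  mul_mem_of_mem_iSup (fun i j x hx y hy => c.maxGenEigenspace_le_A (i + j) (by
    rw [Nat.cast_add]; exact mul_mem_maxGenEigenspace c.N_mul hx hy)) hx hy

theorem A_mul_I {x y : Tensor W} (hx : x ∈ c.A) (hy : y ∈ c.I) : x * y ∈ c.I :=
  mul_mem_of_mem_iSup (fun i j x hx y hy => c.maxGenEigenspace_le_I (i + j) (by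
    rw [add_assoc, Nat.cast_add]; exact mul_mem_maxGenEigenspace c.N_mul hx hy)) hx hy

theorem I_mul_A {x y : Tensor W} (hx : x ∈ c.I) (hy : y ∈ c.A) : x * y ∈ c.I :=
  mul_mem_of_mem_iSup (fun i j x hx y hy => c.maxGenEigenspace_le_I (i + j) (by
    rw [add_right_comm, Nat.cast_add]; exact mul_mem_maxGenEigenspace c.N_mul hx hy)) hx hy

theorem mem_A_of_N_eq_zero {x : Tensor W} (hx : c.N x = 0) : x ∈ c.A := by
  refine c.maxGenEigenspace_le_A 0 ?_
  rw [Module.End.mem_maxGenEigenspace]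
  exact ⟨1, by simp [hx]⟩

/-- `N` is the identity on the generators `h u` and `e h u`, and these span the kernel of `p`. -/
theorem ι_mem_I {w : W.carrier} (hw : c.p w = 0) : ι 𝕜 w ∈ c.I := by
  refine c.maxGenEigenspace_le_I 0 ?_
  rw [Module.End.mem_maxGenEigenspace]
  refine ⟨1, ?_⟩
  have hheh : ∀ u, c.h (c.e (c.h u)) = c.h u := fun u => by
    simpa [c.p_h, c.h_h] using c.dec (c.h u)
  have h1 : ∀ u, c.N (ι 𝕜 (c.h u)) = ι 𝕜 (c.h u) := fun u => by
    rw [N_apply, H_ι, c.h_h, c.D_h, H_ι, hheh, map_zero, map_zero, zero_add]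
  have h2 : ∀ u, c.N (ι 𝕜 (c.e (c.h u))) = ι 𝕜 (c.e (c.h u)) := fun u => by
    rw [N_apply, H_ι, c.D_e_h, hheh, c.D_h, map_zero, add_zero]
  have h3 : c.N (ι 𝕜 w) = ι 𝕜 w := by
    rw [← c.dec w, hw, zero_add, map_add, map_add, h1, h2]
  simp [h3]

theorem N_mem_I {x : Tensor W} (hx : x ∈ c.I) : c.N x ∈ c.I := by
  refine (iSup_le (a := c.I.comap c.N) fun j x hx => ?_) hx
  exact c.maxGenEigenspace_le_I j
    (Module.End.mapsTo_maxGenEigenspace_of_comm (Commute.refl c.N) _ hx)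

theorem N_D {x : Tensor W} (hx : x ∈ freeLie W) : c.N (δ.D x) = δ.D (c.N x) := by
  rw [N_apply, N_apply, map_add, δ.D_D hx, δ.D_D (c.H_mem hx), map_zero, add_zero, zero_add]


theorem bracket_mem_A {i j : ℕ} {a b : Tensor W} (ha : a ∈ c.A) (hb : b ∈ c.A) :
    bracket W i j a b ∈ c.A := by
  rw [bracket]
  exact sub_mem (c.A_mul_A ha hb) (Submodule.smul_mem _ _ (c.A_mul_A hb ha))

theorem bracket_mem_I_left {i j : ℕ} {a b : Tensor W} (ha : a ∈ c.I) (hb : b ∈ c.A) :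
    bracket W i j a b ∈ c.I := by
  rw [bracket]
  exact sub_mem (c.I_mul_A ha hb) (Submodule.smul_mem _ _ (c.A_mul_I hb ha))

theorem bracket_mem_I_right {i j : ℕ} {a b : Tensor W} (ha : a ∈ c.A) (hb : b ∈ c.I) :
    bracket W i j a b ∈ c.I := by
  rw [bracket]
  exact sub_mem (c.A_mul_I ha hb) (Submodule.smul_mem _ _ (c.I_mul_A hb ha))

/-- `H` is a derivation with values in the contractible generators, so every term of `H x` has one
factor in `I` and its other factors in `A`. -/
theorem H_mem_I {n : ℕ} (h : ∀ m < n, ∀ w ∈ W.deg m, ι 𝕜 w ∈ c.A) {m l : ℕ} {x : Tensor W}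
    (hx : IsLieMonomial W ⊤ m l x) (hm : m < n) : x ∈ c.A ∧ c.H x ∈ c.I := by
  induction hx with
  | gen _ hw => exact ⟨h _ hm _ hw, by rw [H_ι]; exact c.ι_mem_I (c.p_h _)⟩
  | @bracket i j p q a b ha hb iha ihb =>
    obtain ⟨ha1, ha2⟩ := iha (by omega)
    obtain ⟨hb1, hb2⟩ := ihb (by omega)
    refine ⟨c.bracket_mem_A ha1 hb1, ?_⟩
    rw [c.H_isOddDer.map_bracket_succ ha.mem_freeLieDeg hb.mem_freeLieDeg]
    exact add_mem (c.bracket_mem_I_left ha2 hb1)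
      (Submodule.smul_mem _ _ (c.bracket_mem_I_right ha1 hb2))

/-- As `hp = 0`, only `H (δ (p w))` remains, and `δ` lowers the degree, so that just the generators
of smaller degree are involved. -/
theorem N_p_mem_I {n : ℕ} (h : ∀ m < n + 1, ∀ w ∈ W.deg m, ι 𝕜 w ∈ c.A) {w : W.carrier}
    (hw : w ∈ W.deg (n + 1)) : c.N (ι 𝕜 (c.p w)) ∈ c.I := by
  rw [N_apply, H_ι, c.h_p, map_zero, map_zero, zero_add]
  have hle : freeLieDeg W n ≤ c.I.comap c.H := by
    refine Submodule.span_le.2 ?_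
    rintro x ⟨l, hx⟩
    exact Submodule.mem_comap.2 (c.H_mem_I h hx n.lt_succ_self).2
  exact Submodule.mem_comap.1 (hle (δ.D_ι_mem (c.p_deg _ w hw)))

variable [CharZero 𝕜]

/-- Characteristic zero enters here: positive integers are nonzero eigenvalues. -/
theorem exists_of_mem_I {z : Tensor W} (hz : z ∈ c.I) :
    ∃ r : 𝕜[X], c.N (aeval c.N r z) = z :=
  exists_aeval_inverse c.N (fun j => Nat.cast_ne_zero.2 j.succ_ne_zero) hz

/-- A polynomial in `N` applied to `N x` gives an element of `I` with the same image as `x` under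
`N`; the difference has eigenvalue zero. -/
theorem mem_A_of_N_mem_I {x : Tensor W} (hx : c.N x ∈ c.I) : x ∈ c.A := by
  obtain ⟨r, hr⟩ := c.exists_of_mem_I hx
  have hg : aeval c.N r (c.N x) ∈ c.I := aeval_mem (fun _ => c.N_mem_I) r hx
  have h0 : x - aeval c.N r (c.N x) ∈ c.A :=
    c.mem_A_of_N_eq_zero (by rw [map_sub, hr, sub_self])
  have h2 := add_mem h0 (c.I_le_A hg)
  rwa [sub_add_cancel] at h2

/-- All generators lie in the sum of the generalized eigenspaces. -/
theorem ι_mem_A (n : ℕ) : ∀ w ∈ W.deg n, ι 𝕜 w ∈ c.A := by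
  induction n using Nat.strong_induction_on with
  | _ n ih =>
    intro w hw
    rcases n with _ | n
    · rw [W.eq_zero_of_deg_zero hw, map_zero]; exact zero_mem _
    have h0 := c.mem_A_of_N_mem_I (c.N_p_mem_I ih hw)
    have h1 : ι 𝕜 (w - c.p w) ∈ c.I := c.ι_mem_I (by rw [map_sub, c.p_p, sub_self])
    have h2 := add_mem h0 (c.I_le_A h1)
    rwa [← map_add, add_sub_cancel] at h2

theorem mem_A (x : Tensor W) : x ∈ c.A :=
  tensor_induction (c.mem_A_of_N_eq_zero (by
    have := c.N_mul 1 1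
    simpa using this)) c.ι_mem_A (fun _ _ => c.A_mul_A) x

/-- True on generators by `ι_mem_I`, and multiplicative because `xy - x'y' = (x - x')y + x'(y - y')`
and `I` is an ideal. -/
theorem sub_mem_I (x : Tensor W) : x - tensorMap c.ofS (c.P x) ∈ c.I := by
  refine tensor_induction
    (p := c.I.comap (LinearMap.id - (tensorMap c.ofS).toLinearMap ∘ₗ c.P.toLinearMap))
    ?_ ?_ ?_ x
  · simp
  · intro n w _
    have : ι 𝕜 (w - c.p w) ∈ c.I := c.ι_mem_I (by rw [map_sub, c.p_p, sub_self])
    simpa [P_ι, ofS_toS] using this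
  · intro x y hx hy
    simp only [Submodule.mem_comap, LinearMap.sub_apply, LinearMap.comp_apply,
      LinearMap.id_apply, AlgHom.toLinearMap_apply, map_mul] at *
    set x' := tensorMap c.ofS (c.P x)
    set y' := tensorMap c.ofS (c.P y)
    have := add_mem (c.I_mul_A hx (c.mem_A y)) (c.A_mul_I (c.mem_A x') hy)
    rwa [sub_mul, mul_sub, sub_add_sub_cancel] at this

theorem mem_I {x : Tensor W} (hx : c.P x = 0) : x ∈ c.I := by
  have := c.sub_mem_I x
  rwa [hx, map_zero, sub_zero] at this

/-! ### The projection is a quasi-isomorphism and has a section -/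

/-- The kernel of the projection is acyclic. -/
theorem exists_primitive {z : Tensor W} (hz : z ∈ freeLie W) (hP : c.P z = 0)
    (hD : δ.D z = 0) : ∃ y ∈ freeLie W, c.P y = 0 ∧ z = δ.D y := by
  -- With `z = N (r(N) z)` and `r(N) z` again a cycle, the homotopy formula reads `z = δ H (r(N)
  -- z)`.
  obtain ⟨r, hr⟩ := c.exists_of_mem_I (c.mem_I hP)
  have hM : aeval c.N r z ∈ freeLie W ⊓ LinearMap.ker δ.D := by
    refine aeval_mem (fun x hx => ?_) r ⟨hz, hD⟩
    obtain ⟨hx, hx'⟩ := hx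
    rw [SetLike.mem_coe, LinearMap.mem_ker] at hx'
    rw [N_apply, hx', map_zero, add_zero]
    exact ⟨δ.D_mem (c.H_mem hx), δ.D_D (c.H_mem hx)⟩
  refine ⟨c.H (aeval c.N r z), c.H_mem hM.1, c.P_H _, ?_⟩
  have hM2 : δ.D (aeval c.N r z) = 0 := hM.2
  rw [N_apply, hM2, map_zero, add_zero] at hr
  exact hr.symm

/-- `P` is surjective with acyclic kernel. The inclusion of `S` lifts elements but need not commute
with the differentials, so each lift is corrected by a primitive. -/
theorem isQuasiIso_P : IsQuasiIso δ c.dS c.P := by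
  have hi : ∀ {y : Tensor c.S}, y ∈ freeLie c.S → tensorMap c.ofS y ∈ freeLie W := fun hy =>
    (tensorMap_isLieMap c.ofS_deg).mem hy
  constructor
  · intro x hx hdx y hy hxy
    obtain ⟨z, hz, -, e⟩ := c.exists_primitive (sub_mem hx (δ.D_mem (hi hy)))
      (by rw [map_sub, P_D, P_tensorMap_ofS, hxy, sub_self])
      (by rw [map_sub, hdx, δ.D_D (hi hy), sub_self])
    exact ⟨z + tensorMap c.ofS y, add_mem hz (hi hy), by rw [map_add, ← e, sub_add_cancel]⟩
  · intro y hy hdy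
    obtain ⟨z, hz, hPz, e⟩ := c.exists_primitive (δ.D_mem (hi hy))
      (by rw [P_D, P_tensorMap_ofS, hdy]) (δ.D_D (hi hy))
    refine ⟨tensorMap c.ofS y - z, sub_mem (hi hy) hz, by rw [map_sub, e, sub_self], 0,
      zero_mem _, ?_⟩
    rw [map_sub, P_tensorMap_ofS, hPz, map_zero, sub_zero, add_zero]

/-- The difference lies in the kernel of `P`, where `N` is injective. Lifts in the kernel of `N` are
therefore unique, hence linear in what they lift. -/
theorem eq_of_N {x y : Tensor W} (hx : c.N x = 0) (hy : c.N y = 0) (h : c.P x = c.P y) :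
    x = y := by
  have h0 : c.N (x - y) = 0 := by rw [map_sub, hx, hy, sub_self]
  obtain ⟨r, hr⟩ := c.exists_of_mem_I (c.mem_I (x := x - y) (by rw [map_sub, h, sub_self]))
  rw [aeval_comm_apply, h0, map_zero] at hr
  exact sub_eq_zero.1 hr.symm

/-- The obvious lift is corrected by an element of the image of `N`, which `P` kills; polynomials in
`N` preserve degrees. -/
theorem exists_lift (s : c.S.carrier) : ∃ g : Tensor W, c.N g = 0 ∧ c.P g = ι 𝕜 s ∧
    ∀ n, s ∈ c.S.deg n → g ∈ freeLieDeg W n := by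
  have hs : c.N (ι 𝕜 (c.ofS s)) ∈ c.I := c.mem_I (c.P_N _)
  obtain ⟨r, hr⟩ := c.exists_of_mem_I hs
  refine ⟨ι 𝕜 (c.ofS s) - aeval c.N r (c.N (ι 𝕜 (c.ofS s))), by rw [map_sub, hr, sub_self], ?_,
    fun n hn => ?_⟩
  · rw [← aeval_comm_apply, map_sub, P_N, sub_zero, P_ι, toS_ofS]
  · have h1 := ι_mem_freeLieDeg (c.ofS_deg n s hn)
    exact sub_mem h1 (aeval_mem (fun _ => c.N_mem_deg) r (c.N_mem_deg h1))

/-- The projection to the contracted dgl has a section. -/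
theorem exists_section : ∃ f : Tensor c.S →ₐ[𝕜] Tensor W, IsLieMap f ∧
    (∀ x, f (c.dS.D x) = δ.D (f x)) ∧ ∀ x, c.P (f x) = x := by
  choose g hgN hgP hgd using c.exists_lift
  let G : c.S.carrier →ₗ[𝕜] Tensor W :=
    { toFun := g
      map_add' := fun s t => c.eq_of_N (hgN _) (by rw [map_add, hgN, hgN, add_zero])
        (by rw [map_add, hgP, hgP, hgP, map_add])
      map_smul' := fun a s => c.eq_of_N (hgN _) (by rw [map_smul, hgN, smul_zero])
        (by rw [map_smul, hgP, hgP, map_smul]; rfl) }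
  let f : Tensor c.S →ₐ[𝕜] Tensor W := TensorAlgebra.lift 𝕜 G
  have hfι : ∀ s, f (ι 𝕜 s) = g s := fun s => by simp [f, G]
  have hf : IsLieMap f := fun n s hs => by rw [hfι]; exact hgd s n hs
  have hPf : ∀ x, c.P (f x) = x := fun x => by
    have : c.P.comp f = AlgHom.id 𝕜 _ := algHom_ext_deg fun n s _ => by simp [hfι, hgP]
    exact DFunLike.congr_fun this x
  have hNf : ∀ x, c.N (f x) = 0 := fun x => by
    refine tensor_induction (p := LinearMap.ker (c.N ∘ₗ f.toLinearMap)) ?_ ?_ ?_ x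
    · have := c.N_mul 1 1
      simpa using this
    · intro n s _
      simp [hfι, hgN]
    · intro x y hx hy
      simp only [LinearMap.mem_ker, LinearMap.comp_apply, AlgHom.toLinearMap_apply] at *
      rw [map_mul, N_mul, hx, hy, mul_zero, zero_mul, add_zero]
  refine ⟨f, hf, fun x => ?_, hPf⟩
  -- Both sides lie in the kernel of `N` and have the same image under `P`.
  refine c.dS.D_isOddDer.comm hf.sgn δ.D_isOddDer (fun n s hs => c.eq_of_N (hNf _) ?_ ?_) x
  · rw [c.N_D (hf.ι_mem s), hNf, map_zero]
  · rw [hPf, P_D, hPf]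

end StrictContraction

/-! ### Minimal models -/

section QuasiIso

variable {U V W : GradedSpace.{u, v} 𝕜} {d : Differential U} {d' : Differential V}
  {δ : Differential W}

theorem IsQuasiIso.comp {f : Tensor U →ₐ[𝕜] Tensor V} {g : Tensor V →ₐ[𝕜] Tensor W}
    (hg : IsQuasiIso d' δ g) (hf : IsQuasiIso d d' f) (hfL : IsLieMap f) (hgL : IsLieMap g)
    (hfd : ∀ x, f (d.D x) = d'.D (f x)) (hgd : ∀ x, g (d'.D x) = δ.D (g x)) :
    IsQuasiIso d δ (g.comp f) := by
  constructor
  · intro x hx hdx y hy hxy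
    obtain ⟨z, hz, e⟩ := hg.1 (f x) (hfL.mem hx) (by rw [← hfd, hdx, map_zero]) y hy hxy
    exact hf.1 x hx hdx z hz e
  · intro y hy hdy
    obtain ⟨x, hx, hdx, z, hz, e⟩ := hg.2 y hy hdy
    obtain ⟨x', hx', hdx', z', hz', e'⟩ := hf.2 x hx hdx
    refine ⟨x', hx', hdx', g z' + z, add_mem (hgL.mem hz') hz, ?_⟩
    rw [e, e', map_add, map_add, hgd, add_assoc]
    rfl

/-- An isomorphism of dgl's is a quasi-isomorphism. -/
theorem isQuasiIso_of_inverse {f : Tensor V →ₐ[𝕜] Tensor W} {g : Tensor W →ₐ[𝕜] Tensor V}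
    (hg : IsLieMap g) (hgd : ∀ x, g (δ.D x) = d'.D (g x)) (hfg : ∀ x, f (g x) = x)
    (hgf : ∀ x, g (f x) = x) : IsQuasiIso d' δ f := by
  constructor
  · intro x hx hdx y hy hxy
    exact ⟨g y, hg.mem hy, by rw [← hgd, ← hxy, hgf]⟩
  · intro y hy hdy
    exact ⟨g y, hg.mem hy, by rw [← hgd, hdy, map_zero], 0, zero_mem _, by
      rw [hfg, map_zero, add_zero]⟩

/-- A section of a quasi-isomorphism is a quasi-isomorphism. -/
theorem IsQuasiIso.of_section {f : Tensor W →ₐ[𝕜] Tensor V} {g : Tensor V →ₐ[𝕜] Tensor W}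
    (hf : IsQuasiIso δ d' f) (hfL : IsLieMap f) (hgL : IsLieMap g)
    (hfd : ∀ x, f (δ.D x) = d'.D (f x)) (hgd : ∀ x, g (d'.D x) = δ.D (g x))
    (hfg : ∀ x, f (g x) = x) : IsQuasiIso d' δ g := by
  constructor
  · intro x hx hdx y hy hxy
    exact ⟨f y, hfL.mem hy, by rw [← hfd, ← hxy, hfg]⟩
  · intro y hy hdy
    have h0 : d'.D (f y) = 0 := by rw [← hfd, hdy, map_zero]
    obtain ⟨z, hz, e⟩ := hf.1 (y - g (f y)) (sub_mem hy (hgL.mem (hfL.mem hy)))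
      (by rw [map_sub, hdy, ← hgd, h0, map_zero, sub_self]) 0 (zero_mem _)
      (by rw [map_sub, hfg, sub_self, map_zero])
    exact ⟨f y, hfL.mem hy, h0, z, hz, by rw [← e, add_sub_cancel]⟩

end QuasiIso

section Model

variable {W : GradedSpace.{u, v} 𝕜}

theorem ι_mem_lieOn {U : Submodule 𝕜 W.carrier} (hU : W.IsGraded U) {w : W.carrier}
    (hw : w ∈ U) : ι 𝕜 w ∈ lieOn W U :=
  W.mem_of_proj (U := (lieOn W U).comap (ι 𝕜)) fun n =>
    lieOnDeg_le_lieOn n (ι_mem_lieOnDeg (hU n w hw) (W.proj_mem n w))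

theorem lin_tensorMap {V : GradedSpace.{u, v} 𝕜} {g : W.carrier →ₗ[𝕜] V.carrier}
    (hg : ∀ n, ∀ w ∈ W.deg n, g w ∈ V.deg n) {x : Tensor W} (hx : x ∈ freeLie W) :
    lin V (tensorMap g x) = g (lin W x) := by
  rw [lin_map (tensorMap_isLieMap hg) hx, tensorMap_ι, lin_ι]

/-- A free dgl with a contraction of the linear part of its differential is isomorphic to one with
a strict contraction. -/
theorem exists_strictContraction (δ : Differential W) {p h e : W.carrier →ₗ[𝕜] W.carrier}
    (he : ∀ w, e w = lin W (δ.D (ι 𝕜 w))) (hed : ∀ n, ∀ w ∈ W.deg (n + 1), e w ∈ W.deg n)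
    (hee : ∀ w, e (e w) = 0) (p_deg : ∀ n, ∀ w ∈ W.deg n, p w ∈ W.deg n)
    (h_deg : ∀ n, ∀ w ∈ W.deg n, h w ∈ W.deg (n + 1)) (dec : ∀ w, p w + h (e w) + e (h w) = w)
    (h_h : ∀ w, h (h w) = 0) (h_p : ∀ w, h (p w) = 0) (p_h : ∀ w, p (h w) = 0)
    (p_e : ∀ w, p (e w) = 0) : ∃ (δ' : Differential W) (c : StrictContraction δ')
      (α β : Tensor W →ₐ[𝕜] Tensor W), c.p = p ∧ IsLieMap α ∧ IsLieMap β ∧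
      (∀ x, α (β x) = x) ∧ (∀ x, β (α x) = x) ∧ (∀ x, α (δ'.D x) = δ.D (α x)) ∧
      (∀ x, β (δ.D x) = δ'.D (β x)) ∧
      (∀ w, α (ι 𝕜 w) = ι 𝕜 (p w) + ι 𝕜 (h (e w)) + δ.D (ι 𝕜 (h w))) ∧
      ∀ w, lin W (β (ι 𝕜 w)) = w := by
  -- In `w = p w + h e w + e h w` the last term is replaced by `δ (h w)`, whose linear part it is.
  -- The linear part of `α` is thus the identity.
  let α : Tensor W →ₐ[𝕜] Tensor W :=
    TensorAlgebra.lift 𝕜 (ι 𝕜 ∘ₗ p + ι 𝕜 ∘ₗ h ∘ₗ e + δ.D ∘ₗ ι 𝕜 ∘ₗ h)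
  have hαι : ∀ w, α (ι 𝕜 w) = ι 𝕜 (p w) + ι 𝕜 (h (e w)) + δ.D (ι 𝕜 (h w)) := fun w => by
    simp [α]
  have hα : IsLieMap α := fun n w hw => by
    rcases n with _ | n
    · rw [W.eq_zero_of_deg_zero hw, map_zero, map_zero]; exact zero_mem _
    rw [hαι]
    exact add_mem (add_mem (ι_mem_freeLieDeg (p_deg _ w hw))
      (ι_mem_freeLieDeg (h_deg _ _ (hed n w hw)))) (δ.D_ι_mem (h_deg _ w hw))
  have hlin : ∀ w, lin W (α (ι 𝕜 w)) = w := fun w => by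
    rw [hαι, map_add, map_add, lin_ι, lin_ι, ← he, dec]
  obtain ⟨β, hβ, hαβ, hβα⟩ := exists_inverse_of_forall hα fun n =>
    ⟨fun w _ hw0 => by rwa [hlin] at hw0, fun w hw => ⟨w, hw, hlin w⟩⟩
  have hβlin : ∀ w, lin W (β (ι 𝕜 w)) = w := fun w => by
    have h1 := lin_map hα (hβ.ι_mem w)
    rw [hαβ, lin_ι, hlin] at h1
    exact h1.symm
  -- The transported differential `α⁻¹ δ α`, on generators.
  let g : W.carrier →ₗ[𝕜] Tensor W := β.toLinearMap ∘ₗ δ.D ∘ₗ α.toLinearMap ∘ₗ ι 𝕜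
  have hg : ∀ w, g w = β (δ.D (α (ι 𝕜 w))) := fun w => rfl
  have hgd : ∀ n, ∀ w ∈ W.deg (n + 1), g w ∈ freeLieDeg W n := fun n w hw =>
    hβ.mem_deg (δ.D_mem_deg (hα _ w hw))
  have hαder : ∀ x, α (der g x) = δ.D (α x) :=
    (der_isOddDer g).comm hα.sgn δ.D_isOddDer fun n w _ => by rw [der_ι, hg, hαβ]
  have hg0 : ∀ w, der g (g w) = 0 := fun w => by
    rw [← hβα (der g (g w)), hαder, hg, hαβ, δ.D_D (hα.ι_mem w), map_zero]
  have hD : ∀ x, α ((Differential.ofGen g hgd hg0).D x) = δ.D (α x) :=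
    (Differential.D_isOddDer _).comm hα.sgn δ.D_isOddDer fun n w _ => by
      rw [Differential.ofGen_D_ι g hgd hg0, hg, hαβ]
  have hheh : ∀ w, h (e (h w)) = h w := fun w => by
    simpa [p_h, h_h] using dec (h w)
  -- `α` fixes `h w` and sends `e h w` to `δ (h w)`.
  have D_h : ∀ w, (Differential.ofGen g hgd hg0).D (ι 𝕜 (h w)) = ι 𝕜 (e (h w)) := fun w => by
    have h1 : α (ι 𝕜 (h w)) = ι 𝕜 (h w) := by
      rw [hαι, p_h, h_h, hheh, map_zero, map_zero, zero_add, add_zero]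
    have h2 : α (ι 𝕜 (e (h w))) = δ.D (ι 𝕜 (h w)) := by
      rw [hαι, p_e, hee, hheh, map_zero, map_zero, map_zero, zero_add, zero_add]
    rw [Differential.ofGen_D_ι g hgd hg0, hg, h1, ← h2, hβα]
  refine ⟨.ofGen g hgd hg0, ⟨p, h, e, p_deg, h_deg, dec, h_h, h_p, p_h, p_e, D_h⟩, α, β, rfl, hα,
    hβ, hαβ, hβα, hD, fun x => ?_, hαι, hβlin⟩
  rw [← hβα ((Differential.ofGen g hgd hg0).D (β x)), hD, hαβ]

/-- A free dgl with a decomposition of length `k` retracts to a minimal dgl, with a filtration of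
length `k` of its generators. -/
theorem exists_minimal_retract [CharZero 𝕜] (δ : Differential W) {k : ℕ} (E : Decomposition δ k) :
    ∃ (S : GradedSpace.{u, v} 𝕜) (d : Differential S) (f : Tensor W →ₐ[𝕜] Tensor S)
      (g : Tensor S →ₐ[𝕜] Tensor W) (G : ℕ → Submodule 𝕜 S.carrier),
      IsLieMap f ∧ IsLieMap g ∧ (∀ x, f (δ.D x) = d.D (f x)) ∧ (∀ x, g (d.D x) = δ.D (g x)) ∧
      (∀ x, f (g x) = x) ∧ IsQuasiIso δ d f ∧ d.IsMinimal ∧ Monotone G ∧ G 0 = ⊥ ∧ G k = ⊤ ∧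
      (∀ i, S.IsGraded (G i)) ∧
      (∀ i, ∀ s ∈ G (i + 1), lenComp S 2 (d.D (ι 𝕜 s)) ∈ lieOn S (G i)) ∧
      ∀ s, d.D (ι 𝕜 s) ∈ lieOn S (G (k - 1)) := by
  let e : W.carrier →ₗ[𝕜] W.carrier := lin W ∘ₗ δ.D ∘ₗ ι 𝕜
  have he : ∀ w, e w = lin W (δ.D (ι 𝕜 w)) := fun w => rfl
  have hed : ∀ n, ∀ w ∈ W.deg (n + 1), e w ∈ W.deg n := fun n w hw =>
    (lin_mem_deg (U := ⊤) (δ.D_ι_mem hw)).2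
  have hee : ∀ w, e (e w) = 0 := fun w => by
    rw [he (e w), he w, ← δ.lin_D (δ.D_mem (ι_mem_freeLie W w)), δ.D_D (ι_mem_freeLie W w),
      map_zero]
  -- Shifted by one, so that `F i` is the sum of the first `i` pieces.
  let F : ℕ → Submodule 𝕜 W.carrier := fun i => below E.piece (i + 1)
  have hF : Monotone F := fun i j hij => below_mono _ (by omega)
  have hF0 : F 0 = ⊥ := by simp [F, below]
  have hFk : F k = ⊤ := E.below_eq_top
  have hFg : ∀ i, W.IsGraded (F i) := fun i => E.isGraded_below _
  have hFD : ∀ i, ∀ w ∈ F (i + 1), δ.D (ι 𝕜 w) ∈ lieOn W (F i) := fun i w hw =>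
    E.D_mem_below hw
  obtain ⟨p, h, p_deg, h_deg, dec, h_h, h_p, p_h, p_e, e_p, hpF⟩ :=
    W.exists_contraction hF hF0 hFk hFg hed hee
  obtain ⟨δ', c, α, β, hcp, hα, hβ, hαβ, hβα, hαD, hβD, hαι, hβlin⟩ :=
    exists_strictContraction δ he hed hee p_deg h_deg dec h_h h_p p_h p_e
  subst hcp
  obtain ⟨g, hg, hgD, hPg⟩ := c.exists_section
  have hfL : IsLieMap (c.P.comp β) := c.P_isLieMap.comp hβ
  have hfD : ∀ x, c.P.comp β (δ.D x) = c.dS.D (c.P.comp β x) := fun x => by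
    rw [AlgHom.comp_apply, AlgHom.comp_apply, hβD, c.P_D]
  have hpofS : ∀ s, c.p (c.ofS s) = c.ofS s := fun s => by rw [← c.ofS_toS, c.toS_ofS]
  have heofS : ∀ s, lin W (δ.D (ι 𝕜 (c.ofS s))) = 0 := fun s => by
    rw [← he, ← hpofS, e_p]
  have hαS : ∀ s, α (ι 𝕜 (c.ofS s)) = ι 𝕜 (c.ofS s) := fun s => by
    rw [hαι, ← hpofS, h_p, e_p, c.p_p]
    simp only [map_zero, add_zero]
  have hdS : ∀ s, c.dS.D (ι 𝕜 s) = c.P (β (δ.D (ι 𝕜 (c.ofS s)))) := fun s => by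
    rw [c.dS_ι, hβD, ← hαS, hβα, hαS]
  have hlinβ : ∀ x ∈ freeLie W, lin W (β x) = lin W x := fun x hx => by
    rw [lin_map hβ hx, hβlin]
  have hmin : c.dS.IsMinimal := by
    rw [isMinimal_iff]
    intro s
    have hm := δ.D_mem (ι_mem_freeLie W (c.ofS s))
    rw [hdS, StrictContraction.P, lin_tensorMap c.toS_deg (hβ.mem hm), hlinβ _ hm, heofS, map_zero]
  have hlf : linMap (c.P.comp β) = c.toS := LinearMap.ext fun w => by
    rw [linMap_apply, AlgHom.comp_apply, StrictContraction.P,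
      lin_tensorMap c.toS_deg (hβ.ι_mem w), hβlin]
  -- The filtration on `S` is induced from `W`; here it matters that `p` preserves the `F i`.
  have htoS : ∀ i, ∀ w ∈ F i, c.toS w ∈ (F i).comap c.ofS := fun i w hw => by
    rw [Submodule.mem_comap, c.ofS_toS]; exact hpF i w hw
  refine ⟨c.S, c.dS, c.P.comp β, α.comp g, fun i => (F i).comap c.ofS, hfL, hα.comp hg, hfD,
    fun x => ?_, fun x => ?_, ?_, hmin, fun i j hij => Submodule.comap_mono (hF hij), ?_, ?_,
    fun i => (hFg i).comap c.ofS_deg, fun i s hs => ?_, fun s => ?_⟩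
  · rw [AlgHom.comp_apply, AlgHom.comp_apply, hgD, hαD]
  · rw [AlgHom.comp_apply, AlgHom.comp_apply, hβα, hPg]
  · exact c.isQuasiIso_P.comp (isQuasiIso_of_inverse hα hαD hβα hαβ) hβ c.P_isLieMap hβD c.P_D
  · rw [eq_bot_iff]
    intro s hs
    have hs' : c.ofS s ∈ F 0 := hs
    rw [hF0, Submodule.mem_bot] at hs'
    rw [Submodule.mem_bot, ← c.toS_ofS s, hs', map_zero]
  · change (F k).comap c.ofS = ⊤
    rw [hFk, Submodule.comap_top]
  · have h1 := hmin.lenComp_two_linMap hfL hfD (heofS s)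
    rw [hlf, c.toS_ofS] at h1
    rw [h1]
    exact tensorMap_mem_lieOn c.toS_deg (htoS i)
      (lenComp_mem_lieOn 2 (hFD i (c.ofS s) (Submodule.mem_comap.1 hs)))
  -- For length zero all spaces vanish, so the truncated `k - 1` is harmless.
  · rcases k with _ | k
    · have : c.ofS s = 0 := by
        rw [← Submodule.mem_bot 𝕜, ← hF0, hFk]; trivial
      rw [hdS, this, map_zero, map_zero, map_zero, map_zero]
      exact zero_mem _
    have hFD' : ∀ w, δ.D (ι 𝕜 w) ∈ lieOn W (F k) := fun w => hFD k w (by rw [hFk]; trivial)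
    have hαF : ∀ n, ∀ w ∈ F k ⊓ W.deg n, α (ι 𝕜 w) ∈ lieOnDeg W (F k) n := by
      intro n w hw
      refine mem_lieOnDeg_of_mem ?_ (hα n w hw.2)
      -- `h` alone need not respect the filtration, but `he = 1 - p - eh`, and the values of `e` lie
      -- in `F k` because those of `δ` lie in `𝕃(F k)`.
      have h1 : h (e w) ∈ F k := by
        have h2 : h (e w) = w - c.p w - e (h w) := by
          rw [eq_sub_iff_add_eq, eq_sub_iff_add_eq]
          refine Eq.trans ?_ (dec w)
          abel
        rw [h2]
        exact sub_mem (sub_mem hw.1 (hpF k w hw.1)) (lin_mem_of_lieOn (hFD' _))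
      rw [hαι]
      exact add_mem (add_mem (ι_mem_lieOn (hFg k) (hpF k w hw.1)) (ι_mem_lieOn (hFg k) h1))
        (hFD' _)
    -- `α` maps `𝕃(F k)` onto itself, being the identity on linear parts there; so its inverse `β`
    -- preserves `𝕃(F k)` as well.
    have hαs : ∀ x ∈ lieOn W (F k), x ∈ (lieOn W (F k)).map α.toLinearMap := fun x hx =>
      mem_of_forall_degComp (lieOn_le_freeLie hx) fun n => by
        refine Submodule.map_mono (lieOnDeg_le_lieOn n)
          (lieOnDeg_le_map (Q := fun _ => True) (fun _ _ _ _ => trivial) hαF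
            (fun m _ w hw => ⟨w, hw, ?_⟩) n trivial (degComp_mem_lieOnDeg n hx))
        rw [hαι, map_add, map_add, lin_ι, lin_ι, ← he, dec]
    obtain ⟨y, hy, hyx⟩ := hαs _ (hFD' (c.ofS s))
    rw [hdS, ← hyx, AlgHom.toLinearMap_apply, hβα]
    exact tensorMap_mem_lieOn c.toS_deg (htoS k) hy

end Model

end GradedLie

/-! ### The theorem -/

open GradedLie TensorAlgebra

theorem mainTheorem4 {𝕜 : Type v} [Field 𝕜] [CharZero 𝕜]
    (W : GradedLie.GradedSpace.{u, v} 𝕜) (δ : GradedLie.Differential W)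
    (k : ℕ) (D : GradedLie.Decomposition δ k) :
    (∃ (V : GradedLie.GradedSpace.{u, v} 𝕜) (d : GradedLie.Differential V)
      (φ : GradedLie.Hom d δ), φ.IsMinimalModel) ∧
    ∀ (V : GradedLie.GradedSpace.{u, v} 𝕜) (d : GradedLie.Differential V)
      (φ : GradedLie.Hom d δ), φ.IsMinimalModel →
      (∃ d₂ : GradedLie.Differential V, d.IsQuadraticPart d₂ ∧
        Nonempty (GradedLie.Decomposition d₂ k)) ∧
      ∃ (K : GradedLie.GradedSpace.{u, v} 𝕜) (dK : GradedLie.Differential K)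
        (θ : GradedLie.Hom dK d), Function.Bijective θ.toFun ∧ dK.IsMinimal ∧
        ∃ dK₂ : GradedLie.Differential K, dK.IsQuadraticPart dK₂ ∧
          ∃ E : GradedLie.Decomposition dK₂ k, ∀ x : K.carrier,
            (dK.d (GradedLie.gen K x) : GradedLie.Tensor K) ∈
              GradedLie.lieOn K (GradedLie.below E.piece k) := by
  obtain ⟨S, dS, f, g, G, hf, hg, hfD, hgD, hfg, hfq, hmin, hG, hG0, hGk, hGg, hG2, hGd⟩ :=
    exists_minimal_retract δ D
  refine ⟨⟨S, dS, .ofTensor g hg hgD, hmin, fun x y hxy => Subtype.ext ?_,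
    (hfq.of_section hf hg hfD hgD hfg).ofTensor⟩, fun V d φ hφ => ?_⟩
  · have h1 : g x = g y := congrArg Subtype.val hxy
    rw [← hfg x, h1, hfg]
  -- The given model followed by the retraction to `S` is a quasi-isomorphism of minimal dgl's,
  -- hence invertible.
  have hq := hfq.comp (Hom.isQuasiIso hφ.quasiIso) φ.tensor_isLieMap hf φ.tensor_D hfD
  have hL : IsLieMap (f.comp φ.tensor) := hf.comp φ.tensor_isLieMap
  have hD : ∀ x, f.comp φ.tensor (d.D x) = dS.D (f.comp φ.tensor x) := fun x => by
    rw [AlgHom.comp_apply, AlgHom.comp_apply, φ.tensor_D, hfD]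
  generalize f.comp φ.tensor = F at hq hL hD
  obtain ⟨F', hF', hFF', hF'F⟩ :=
    exists_inverse_of_forall hL (hq.linBijective hL hD hφ.minimal hmin)
  have hl : ∀ s, linMap F (linMap F' s) = s := fun s => by
    rw [linMap_apply, linMap_apply, ← lin_map hL (hF'.ι_mem s), hFF', lin_ι]
  have hl' : ∀ v, linMap F' (linMap F v) = v := fun v => by
    rw [linMap_apply, linMap_apply, ← lin_map hF' (hL.ι_mem v), hF'F, lin_ι]
  have hF'D : ∀ x, F' (dS.D x) = d.D (F' x) := fun x => by
    rw [← hF'F (d.D (F' x)), hD, hFF']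
  constructor
  · obtain ⟨d₂, hd₂, hd₂D⟩ := hφ.minimal.exists_isQuadraticPart
    refine ⟨d₂, hd₂, ?_⟩
    -- The filtration is pulled back along the linear part of `F`, which suffices because it
    -- intertwines the quadratic parts.
    obtain ⟨E, -⟩ := exists_decomposition d₂ (F := fun i => (G i).comap (linMap F)) (k := k)
      (fun i j hij => Submodule.comap_mono (hG hij)) (by
        rw [eq_bot_iff]
        intro v hv
        rw [Submodule.mem_comap, hG0, Submodule.mem_bot] at hv
        rw [Submodule.mem_bot, ← hl' v, hv, map_zero])
      (by rw [hGk, Submodule.comap_top]) (fun i => (hGg i).comap (linMap_mem_deg hL))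
      (fun i v hv => by
        have h1 := hmin.lenComp_two_linMap hL hD ((isMinimal_iff d).1 hφ.minimal v)
        have h2 := hG2 i _ (Submodule.mem_comap.1 hv)
        rw [h1] at h2
        have h3 := tensorMap_mem_lieOn (U' := (G i).comap (linMap F)) (linMap_mem_deg hF')
          (fun s hs => by rw [Submodule.mem_comap, hl]; exact hs) h2
        have h4 : (tensorMap (linMap F')).comp (tensorMap (linMap F)) = AlgHom.id 𝕜 _ :=
          algHom_ext_deg fun n v _ => by simp [hl']
        rw [← AlgHom.comp_apply, h4] at h3
        rw [hd₂D]
        exact h3)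
    exact ⟨E⟩
  · obtain ⟨d₂, hd₂, hd₂D⟩ := hmin.exists_isQuadraticPart
    obtain ⟨E, hE⟩ := exists_decomposition d₂ hG hG0 hGk hGg
      fun i s hs => by rw [hd₂D]; exact hG2 i s hs
    -- The new generators are the images of `S` under the inverse isomorphism.
    refine ⟨S, dS, .ofTensor F' hF' hF'D, ⟨fun x y hxy => Subtype.ext ?_, fun y =>
      ⟨⟨F y, hL.mem y.2⟩, Subtype.ext (hF'F y)⟩⟩, hmin, d₂, hd₂, E, fun s => ?_⟩
    · have h1 : F' x = F' y := congrArg Subtype.val hxy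
      rw [← hFF' x, h1, hFF']
    · have h1 := hGd s
      rw [← dS.D_ι]
      rcases k with _ | k
      · have : s = 0 := by rw [← Submodule.mem_bot 𝕜, ← hG0, hGk]; trivial
        rw [this, map_zero, map_zero]
        exact zero_mem _
      · rw [hE k k.le_succ]
        exact h1
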